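/- **Setting.** Let $0<d<k$ with $d\ge 2$. For a linear map $L:\mathbb R^d\to\mathbb R^{k-d}$, identified with its matrix $(\alpha_{ij})\in\mathbb R^{d(k-d)}$, let $E=\{(x,L(x)) : x\in\mathbb R^d\}\subset\mathbb R^k$, and let $F_\pi$ be a linear complement of $E$ in $\mathbb R^k$, with projections $\pi$ onto $E$ and $\pi^*$ onto $F_\pi$. Assume that $E+\mathbb Z^k$ is dense in $\mathbb R^k$ and that $\pi$ is injective on $\mathbb Z^k$. Put $F_\rho=\{0\}^d\times\mathbb R^{k-d}$, let $\rho$ be the projection onto $E$ along $F_\rho$, and let $\mathcal S=\pi^*(\{0\}^d\times[0,1]^{k-d})+E$. For $s\in\mathbb R^k$ let $Y=Y_s=\pi(\mathcal S\cap(\mathbb Z^k+s))$; it is called regular if $\partial\mathcal S\cap(\mathbb Z^k+s)=\emptyset$. For $y\in Y$ let $\tilde y$ be the unique point of $\mathbb Z^k+s$ with $\pi(\tilde y)=y$. **Patches.** For a bounded convex $\Omega\subset E$ containing a neighbourhood of the origin and $r>0$, put $$P_{\rm I}(y,r\Omega)=\{y'\in Y : y'-y\in r\Omega\},\qquad P_{\rm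 II}(y,r\Omega)=\{y'\in Y : \tilde y'-\tilde y\in\rho^{-1}(r\Omega)\}.$$ For either type, $P(y_1,r\Omega)$ and $P(y_2,r\Omega)$ are equivalent if $P(y_1,r\Omega)-y_1=P(y_2,r\Omega)-y_2$; write $\mathcal P(y,r\Omega)$ for the equivalence class. In what follows, a patch $\mathcal P$ is an equivalence class, of type I or II and for some $r\Omega$, of a patch that occurs in a regular $Y_s$. Its frequency is $$\xi_{\mathcal P}=\lim_{R\to\infty}\frac{\#\{y'\in Y : \mathcal P(y',r\Omega)=\mathcal P,\ \tilde y'-\tilde y\in[-R,R]^d\times\mathbb R^{k-d}\}}{\#\{y'\in Y : \tilde y'-\tilde y\in[-R,R]^d\times\mathbb R^{k-d}\}},$$ and for bounded $A\subset E$ put $$\xi'_{\mathcal P}(y,A)=\frac{\#\{y'\in Y\cap(A+y) : \mathcal P(y',r\Omega)=\mathcal P\}}{\#(Y\cap(A+y))}.$$ For $X\subset E$ let $N_\kappa(X)$ be the set of points of $E$ within distance $\kappa$ of $X$, let $X^{\rm c}$ be the closure in $E$ of $E\setminus X$, let $\partial X$ be the boundary of $X$ in $E$, and let $|X|$ be the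 Lebesgue measure of $X$ on $E$. **Corollary.** For Lebesgue almost every $L$, and for every $F_\pi$ as above, the limit $\xi_{\mathcal P}$ exists for every patch $\mathcal P$ and does not depend on the regular set $Y=Y_s$ or on $y\in Y$, and the following holds. 1. There is $\kappa>0$, depending only on $\pi$, such that for every patch $\mathcal P$ there is a constant $C$ such that, for every regular $Y=Y_s$, every $y\in Y$ and every bounded $A\subset E$ with $|A\cap N_\kappa(A^{\rm c})^{\rm c}|>0$, the set $Y\cap(A+y)$ is non-empty and $$|\xi'_{\mathcal P}(y,A)-\xi_{\mathcal P}|\le C\,\frac{|N_\kappa(\partial A)|}{|A\cap N_\kappa(A^{\rm c})^{\rm c}|}.$$ For type II patches, $C$ can be chosen independently of $\mathcal P$. 2. For every bounded convex $A\subset E$ containing a neighbourhood of the origin and every patch $\mathcal P$ there are constants $C$ and $R_0$ such that, for every regular $Y=Y_s$, every $y\in Y$ and every $R\ge R_0$, $$|\xi'_{\mathcal P}(y,RA)-\xi_{\mathcal P}|\le C R^{-1}.$$ For type II patches, $C$ and $R_0$ can be chosen independently of $\mathcal P$ (they depend only on $L$, $\pi$ and $A$). -/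

import Mathlib

open Set Filter Topology MeasureTheory
open scoped Pointwise

noncomputable section

/-- The total space `ℝᵏ` with `k = d + m`, its first `d` and last `m` coordinates kept apart.
The norm is the maximum norm. -/
abbrev AmbientSpace (d m : ℕ) : Type := (Fin d → ℝ) × (Fin m → ℝ)

/-- The lattice `ℤᵏ ⊆ ℝᵏ`. -/
def intLattice (d m : ℕ) : Set (AmbientSpace d m) :=
  Set.range fun z : (Fin d → ℤ) × (Fin m → ℤ) =>
    ((fun i => (z.1 i : ℝ), fun j => (z.2 j : ℝ)) : AmbientSpace d m)

/-- The linear map `L : ℝᵈ → ℝᵐ` with `L(x)ᵢ = ∑ⱼ αᵢⱼ xⱼ`. -/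
def linMap {d m : ℕ} (α : Fin m → Fin d → ℝ) : (Fin d → ℝ) →ₗ[ℝ] (Fin m → ℝ) :=
  Matrix.mulVecLin (Matrix.of α)

/-- The physical space `E = {(x, L x)}`. -/
def physicalSpace {d m : ℕ} (α : Fin m → Fin d → ℝ) : Submodule ℝ (AmbientSpace d m) :=
  (linMap α).graph

/-- The data of a cubical cut and project scheme whose physical space `E` is the graph of a
linear map, under the conventional assumptions that `E` is totally irrational and that the
projection `π` to `E` along the internal space `F_π` is injective on `ℤᵏ`. -/
structure CutProjectScheme (d m : ℕ) where
  /-- the coefficients of the linear map whose graph is the physical space -/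
  coeff : Fin m → Fin d → ℝ
  /-- the internal space `F_π` -/
  internal : Submodule ℝ (AmbientSpace d m)
  isCompl : IsCompl (physicalSpace coeff) internal
  totallyIrrational :
    Dense ((physicalSpace coeff : Set (AmbientSpace d m)) + intLattice d m)
  injOn : Set.InjOn (Submodule.projectionOnto (physicalSpace coeff) internal isCompl)
    (intLattice d m)

/-- The two types of patches: in type I patches the points are selected by their position in the
physical space, in type II patches by the position of their lifts. -/
inductive PatchType : Type
  | typeI
  | typeII

namespace CutProjectScheme

variable {d m : ℕ} (S : CutProjectScheme d m)

/-- The physical space. -/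
abbrev E : Submodule ℝ (AmbientSpace d m) := physicalSpace S.coeff

/-- The projection `π` to `E` along the internal space. -/
def proj : AmbientSpace d m →ₗ[ℝ] S.E :=
  Submodule.projectionOnto S.E S.internal S.isCompl

/-- The projection `π*` to the internal space along `E`. -/
def projInt : AmbientSpace d m →ₗ[ℝ] S.internal :=
  Submodule.projectionOnto S.internal S.E S.isCompl.symm

/-- The projection `ρ` to `E` along the reference space `F_ρ = {0}ᵈ × ℝᵐ`. -/
def rho (x : AmbientSpace d m) : S.E :=
  ⟨(x.1, linMap S.coeff x.1), rfl⟩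

/-- The cubical window: the image under `π*` of the unit cube of the reference space. -/
def window : Set (AmbientSpace d m) :=
  (fun x => (S.projInt x : AmbientSpace d m)) '' {x : AmbientSpace d m | x.1 = 0 ∧ x.2 ∈ Set.Icc 0 1}

/-- The slice `𝒮 = 𝒲_π + E`. -/
def slice : Set (AmbientSpace d m) := S.window + (S.E : Set (AmbientSpace d m))

/-- The translated lattice `ℤᵏ + s`. -/
def lat (s : AmbientSpace d m) : Set (AmbientSpace d m) := (fun x => x + s) '' intLattice d m

/-- The cut and project set `Y_s = π(𝒮 ∩ (ℤᵏ + s))`. -/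
def Y (s : AmbientSpace d m) : Set S.E := S.proj '' (S.slice ∩ lat s)

/-- `s`, or `Y_s`, is regular if the boundary of the slice contains no point of `ℤᵏ + s`. -/
def IsRegular (s : AmbientSpace d m) : Prop := frontier S.slice ∩ lat s = ∅

/-- For `y ∈ Y_s`, the unique point `ỹ` of `ℤᵏ + s` with `π(ỹ) = y`. -/
def lift (s : AmbientSpace d m) (y : S.E) : AmbientSpace d m :=
  Function.invFunOn S.proj (lat s) y

/-- The patch of the given type and of shape `V` (later `V = rΩ`) at the point `y` of `Y_s`. -/
def patch (t : PatchType) (s : AmbientSpace d m) (y : S.E) (V : Set S.E) : Set S.E :=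
  match t with
  | .typeI => {y' | y' ∈ S.Y s ∧ y' - y ∈ V}
  | .typeII => {y' | y' ∈ S.Y s ∧ S.rho (S.lift s y' - S.lift s y) ∈ V}

/-- The equivalence class of the patch at `y`, represented by the patch translated by `-y`: two
patches are equivalent if and only if these translates agree. -/
def patchClass (t : PatchType) (s : AmbientSpace d m) (y : S.E) (V : Set S.E) : Set S.E :=
  (fun y' => y' - y) '' S.patch t s y V

/-- `P` is the equivalence class of a patch of the given type and of shape `rΩ` that occurs in a
regular cut and project set of the scheme, where `Ω ⊆ E` is convex and bounded and contains a
neighbourhood of the origin. -/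
def IsPatch (t : PatchType) (Ω : Set S.E) (r : ℝ) (P : Set S.E) : Prop :=
  Convex ℝ Ω ∧ Bornology.IsBounded Ω ∧ Ω ∈ 𝓝 (0 : S.E) ∧ 0 < r ∧
    ∃ s, S.IsRegular s ∧ ∃ y ∈ S.Y s, S.patchClass t s y (r • Ω) = P

/-- The points `y'` of `Y_s` with `ỹ' - ỹ ∈ [-R, R]ᵈ × ℝᵐ`. -/
def boxPoints (s : AmbientSpace d m) (y : S.E) (R : ℝ) : Set S.E :=
  {y' | y' ∈ S.Y s ∧ ∀ i, |(S.lift s y' - S.lift s y).1 i| ≤ R}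

/-- The proportion `ξ_P(y, R)` of occurrences of `P` in the box of size `R` about `y`. -/
def boxFreq (t : PatchType) (V P : Set S.E) (s : AmbientSpace d m) (y : S.E) (R : ℝ) : ℝ :=
  ({y' | y' ∈ S.boxPoints s y R ∧ S.patchClass t s y' V = P}.ncard : ℝ) /
    ((S.boxPoints s y R).ncard : ℝ)

/-- `ξ` is the frequency `ξ_P` of `P`: the limit of `ξ_P(y, R)` as `R → ∞` exists and equals `ξ`,
for every point `y` of every regular cut and project set of the scheme. -/
def IsFrequency (t : PatchType) (V P : Set S.E) (ξ : ℝ) : Prop :=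
  ∀ s, S.IsRegular s → ∀ y ∈ S.Y s, Tendsto (S.boxFreq t V P s y) atTop (𝓝 ξ)

/-- The set `Y_s ∩ (A + y)`. -/
def searchPoints (s : AmbientSpace d m) (y : S.E) (A : Set S.E) : Set S.E :=
  {y' | y' ∈ S.Y s ∧ y' - y ∈ A}

/-- The proportion `ξ'_P(y, A)` of occurrences of `P` in `Y_s ∩ (A + y)`. -/
def intrinsicFreq (t : PatchType) (V P : Set S.E) (s : AmbientSpace d m) (y : S.E) (A : Set S.E) : ℝ :=
  ({y' | y' ∈ S.searchPoints s y A ∧ S.patchClass t s y' V = P}.ncard : ℝ) /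
    ((S.searchPoints s y A).ncard : ℝ)

/-- Lebesgue measure on `E`, in the coordinates given by the first `d` coordinates of `ℝᵏ`. Any
other normalisation differs by a constant factor that depends only on `E`. -/
def vol (X : Set S.E) : ℝ := volume.real ((fun x : S.E => x.1.1) '' X)

/-- `N_κ(∂A)`, the set of points of `E` within `κ` of the boundary of `A` in `E`. -/
def bdryNhd (κ : ℝ) (A : Set S.E) : Set S.E := Metric.cthickening κ (frontier A)

/-- `A ∩ N_κ(Aᶜ)ᶜ`, where the complement operation is the closure of the set complement. -/
def core (κ : ℝ) (A : Set S.E) : Set S.E :=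
  A ∩ closure (Metric.cthickening κ (closure Aᶜ))ᶜ

/-- The class `P` has a frequency `ξ_P`, and for every point `y` of every regular `Y_s` and every
bounded `A ⊆ E` such that `A ∩ N_κ(Aᶜ)ᶜ` is not a null set, `Y_s ∩ (A + y)` is non-empty and
`|ξ'_P(y, A) - ξ_P| ≤ C |N_κ(∂A)| / |A ∩ N_κ(Aᶜ)ᶜ|`. -/
def RegionBound (κ C : ℝ) (t : PatchType) (V P : Set S.E) : Prop :=
  ∃ ξ, S.IsFrequency t V P ξ ∧
    ∀ s, S.IsRegular s → ∀ y ∈ S.Y s, ∀ A : Set S.E, Bornology.IsBounded A →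
      0 < S.vol (S.core κ A) →
      (S.searchPoints s y A).Nonempty ∧
      |S.intrinsicFreq t V P s y A - ξ| ≤ C * (S.vol (S.bdryNhd κ A) / S.vol (S.core κ A))

/-- The class `P` has a frequency `ξ_P`, and `|ξ'_P(y, RA) - ξ_P| ≤ C R⁻¹` for every point `y` of
every regular `Y_s` and every `R ≥ R₀`. -/
def DilationBound (A : Set S.E) (C R₀ : ℝ) (t : PatchType) (V P : Set S.E) : Prop :=
  ∃ ξ, S.IsFrequency t V P ξ ∧
    ∀ s, S.IsRegular s → ∀ y ∈ S.Y s, ∀ R : ℝ, R₀ ≤ R →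
      |S.intrinsicFreq t V P s y (R • A) - ξ| ≤ C * R⁻¹

end CutProjectScheme

end

noncomputable section

/-! ### Additive characters and a smoothed integer part -/

/-! The points of a regular `Y_s` are indexed by `ℤᵈ`: over each `n` exactly one point of `ℤᵏ + s`
lies in the slice, and its position in the window is the fractional part of `height s - L n`
(`Y_eq_range`, `height_liftPoint`). The patch at that point depends only on this position
(`patchClass_point`). Counting occurrences of a patch in a region thus means counting the `n` in a
finite set `H ⊆ ℤᵈ` for which `t - L n` modulo 1 lies in an acceptance domain `G`.

When `H` is a cube of side `N` and `G` is a box, the count is estimated by Fourier series. The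
indicator of `G` lies between products of differences of smoothed integer parts, whose Fourier
series converge absolutely. A character summed over a cube is a product of `d` geometric sums, large
only when all the linear forms `∑ⱼ hⱼ αⱼᵢ` are close to integers. The weighted series of these
contributions has finite integral over the torus, hence is finite for almost every `L`
(`ae_tsum_linearForms_lt_top`). The Fourier error is then `O(√N)` and the smoothing error `O(N ^ (d
- 2))`, so that `HasSmallDiscrepancy.box` gives `O(N ^ (d - 3 / 2))`, uniformly in the box, in `t`
and in the position of the cube.

This beats the surface `N ^ (d - 1)` of the cube by a power of `N`, which is what allows arbitrary
`H` (`exists_abs_sum_le_card_latticeBoundary`). Approximate `H` at each scale `2 ^ i` by the dyadic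
cubes that it fills by more than half. Cubes in which two consecutive approximations differ have
parents that meet both `H` and its complement in a fixed proportion; by an isoperimetric inequality
(`card_inter_mul_card_sdiff_le`) each such parent contains about `2 ^ (i (d - 1))` boundary points
of `H`. There are few such cubes, and the errors form a geometric series with ratio `1 / √2`. The
total error is a constant times the number of boundary points of `H`.

In `exists_regionBound`, unit cubes compare the index set of `Y ∩ (A + y)` and its lattice boundary
with the volumes of `core κ A` and `bdryNhd κ A`. For dilated convex sets the quotient of these
volumes is `O(1 / R)`. Acceptance domains are Boolean combinations of boxes for type I, with
constants that depend on the patch; for type II they are single boxes (`exists_acceptance_typeII`),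
whence the uniform constants. -/

/-- The additive character `x ↦ exp (2πix)`. -/
def addExp (x : ℝ) : ℂ := Complex.exp (2 * Real.pi * Complex.I * x)

lemma addExp_zero : addExp 0 = 1 := by simp [addExp]

lemma addExp_add (x y : ℝ) : addExp (x + y) = addExp x * addExp y := by
  simp only [addExp, ← Complex.exp_add]; push_cast; ring_nf

lemma addExp_sum {ι : Type*} (s : Finset ι) (f : ι → ℝ) :
    addExp (∑ i ∈ s, f i) = ∏ i ∈ s, addExp (f i) := by
  classical
  induction s using Finset.induction_on with
  | empty => simp [addExp_zero]
  | insert a s ha ih => rw [Finset.sum_insert ha, Finset.prod_insert ha, addExp_add, ih]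

lemma addExp_int (n : ℤ) : addExp n = 1 := by
  rw [addExp, Complex.exp_eq_one_iff]
  exact ⟨n, by push_cast; ring⟩

lemma addExp_nat_mul (n : ℕ) (x : ℝ) : addExp (n * x) = addExp x ^ n := by
  simp only [addExp, ← Complex.exp_nat_mul]; push_cast; ring_nf

lemma norm_addExp (x : ℝ) : ‖addExp x‖ = 1 := by
  rw [addExp, show (2 * Real.pi * Complex.I * x : ℂ) = ((2 * Real.pi * x : ℝ) : ℂ) * Complex.I by
    push_cast; ring, Complex.norm_exp_ofReal_mul_I]

lemma fourier_coe_eq_addExp (n : ℤ) (x : ℝ) : fourier n (x : UnitAddCircle) = addExp (n * x) := by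
  rw [fourier_coe_apply, addExp]; push_cast; ring_nf

lemma addExp_sub_one_eq (x : ℝ) :
    ‖addExp x - 1‖ = 2 * |Real.sin (Real.pi * x)| := by
  rw [addExp, show (2 * Real.pi * Complex.I * x : ℂ) = Complex.I * ((2 * Real.pi * x : ℝ) : ℂ) by
    push_cast; ring, Complex.norm_exp_I_mul_ofReal_sub_one]
  rw [Real.norm_eq_abs, abs_mul, abs_two]
  congr 3
  ring

lemma norm_addExp_sub_one_le (x : ℝ) : ‖addExp x - 1‖ ≤ 2 * Real.pi * |x| := by
  rw [addExp_sub_one_eq, mul_assoc]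
  have h := Real.abs_sin_le_abs (x := Real.pi * x)
  rw [abs_mul, abs_of_pos Real.pi_pos] at h
  linarith

lemma norm_addExp_sub_one_le_two (x : ℝ) : ‖addExp x - 1‖ ≤ 2 := by
  rw [addExp_sub_one_eq]
  have := Real.abs_sin_le_one (Real.pi * x)
  linarith

/-- A continuous approximation of the integer part, linear on `[n, n + δ]`. -/
def smoothFloor (δ x : ℝ) : ℝ := ⌊x⌋ - max 0 (1 - Int.fract x / δ)

lemma smoothFloor_le {δ : ℝ} (x : ℝ) : smoothFloor δ x ≤ ⌊x⌋ := by
  have := le_max_left 0 (1 - Int.fract x / δ)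
  unfold smoothFloor; linarith

/-- Together with `smoothFloor_le` this lets products of differences of smoothed integer parts bound
the indicator of a box from either side, after its endpoints are moved by `δ`. -/
lemma le_smoothFloor {δ : ℝ} (hδ : 0 < δ) (x : ℝ) : (⌊x - δ⌋ : ℝ) ≤ smoothFloor δ x := by
  unfold smoothFloor
  rcases le_or_gt δ (Int.fract x) with h | h
  · have h1 : 1 - Int.fract x / δ ≤ 0 := by
      rw [sub_nonpos, le_div_iff₀ hδ]; linarith
    rw [max_eq_left h1, sub_zero]
    exact_mod_cast Int.floor_le_floor (by linarith)
  · have h0 := Int.fract_nonneg x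
    have h2 : max 0 (1 - Int.fract x / δ) ≤ 1 := by
      refine max_le zero_le_one ?_
      have : 0 ≤ Int.fract x / δ := by positivity
      linarith
    have h3 : ⌊x - δ⌋ < ⌊x⌋ := by
      rw [Int.floor_lt]
      have := Int.self_sub_floor x
      linarith
    have h4 : ((⌊x - δ⌋ + 1 : ℤ) : ℝ) ≤ ⌊x⌋ := by exact_mod_cast h3
    push_cast at h4
    linarith

/-- The Fourier coefficients of the periodic part of `smoothFloor`. -/
def floorCoeff (δ : ℝ) (n : ℤ) : ℂ :=
  (addExp (n * (-δ)) - 1) / (4 * Real.pi ^ 2 * δ * n ^ 2)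

/-- `smoothFloor δ x` is the mean of the integer part over `[x - δ, x]`. Half the second Bernoulli
polynomial is an antiderivative of `u - 1 / 2`, so a difference quotient of its periodic extension
is a mean of the sawtooth. -/
lemma bernoulliFun_two_fract_sub {δ : ℝ} (hδ : 0 < δ) (hδ1 : δ < 1) (x : ℝ) :
    (bernoulliFun 2 (Int.fract (x - δ)) - bernoulliFun 2 (Int.fract x)) / (2 * δ) =
      smoothFloor δ x - x + (1 + δ) / 2 := by
  have h0 := Int.fract_nonneg x
  have h1 := Int.fract_lt_one x
  have hx := Int.self_sub_floor x
  have hfl : (⌊x⌋ : ℝ) - x = - Int.fract x := by linarith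
  rw [bernoulliFun_two, bernoulliFun_two, div_eq_iff (by positivity)]
  unfold smoothFloor
  set u := Int.fract x with hu
  rcases le_or_gt δ u with h | h
  · have h1 : 1 - u / δ ≤ 0 := by
      rw [sub_nonpos, le_div_iff₀ hδ]; linarith
    have h2 : Int.fract (x - δ) = u - δ := by
      rw [Int.fract_eq_iff]
      refine ⟨by linarith, by linarith, ⌊x⌋, by linarith⟩
    rw [max_eq_left h1, h2, show (⌊x⌋ : ℝ) - 0 - x = -u by linarith]
    ring
  · have h1 : 0 ≤ 1 - u / δ := by
      rw [sub_nonneg, div_le_iff₀ hδ]; linarith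
    have h2 : Int.fract (x - δ) = u - δ + 1 := by
      rw [Int.fract_eq_iff]
      refine ⟨by linarith, by linarith, ⌊x⌋ - 1, by push_cast; linarith⟩
    rw [max_eq_right h1, h2, show (⌊x⌋ : ℝ) - (1 - u / δ) - x = -u - (1 - u / δ) by linarith]
    field_simp
    ring

lemma hasSum_bernoulliFun_two_fract (x : ℝ) :
    HasSum (fun n : ℤ => 1 / (n : ℂ) ^ 2 * addExp (n * x))
      ((2 * Real.pi ^ 2 * bernoulliFun 2 (Int.fract x) : ℝ) : ℂ) := by
  have h := hasSum_one_div_pow_mul_fourier_mul_bernoulliFun (k := 2) le_rfl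
    (x := Int.fract x) ⟨Int.fract_nonneg x, (Int.fract_lt_one x).le⟩
  have h2 : (-(2 * Real.pi * Complex.I) ^ 2 / ((Nat.factorial 2 : ℕ) : ℂ) *
      bernoulliFun 2 (Int.fract x) : ℂ) =
      ((2 * Real.pi ^ 2 * bernoulliFun 2 (Int.fract x) : ℝ) : ℂ) := by
    rw [mul_pow, Complex.I_sq]; norm_num [Nat.factorial, -mul_eq_mul_right_iff, -mul_eq_mul_left_iff]
    try ring
  rw [h2] at h
  convert h using 3 with n
  rw [fourier_coe_eq_addExp]
  have : (n : ℝ) * x = n * Int.fract x + ((n * ⌊x⌋ : ℤ) : ℝ) := by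
    push_cast; rw [← mul_add, Int.fract_add_floor]
  rw [this, addExp_add, addExp_int, mul_one]

lemma hasSum_smoothFloor {δ : ℝ} (hδ : 0 < δ) (hδ1 : δ < 1) (x : ℝ) :
    HasSum (fun n : ℤ => floorCoeff δ n * addExp (n * x))
      ((smoothFloor δ x - x + (1 + δ) / 2 : ℝ) : ℂ) := by
  have h := ((hasSum_bernoulliFun_two_fract (x - δ)).sub
    (hasSum_bernoulliFun_two_fract x)).mul_left ((4 * Real.pi ^ 2 * δ : ℂ)⁻¹)
  have hπ : (Real.pi : ℂ) ≠ 0 := by exact_mod_cast Real.pi_ne_zero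
  have hδ' : (δ : ℂ) ≠ 0 := by exact_mod_cast hδ.ne'
  rw [← bernoulliFun_two_fract_sub hδ hδ1]
  convert! h using 1
  · funext n
    rw [sub_eq_add_neg x δ, mul_add, addExp_add, floorCoeff]
    -- At `n = 0` both sides vanish because division by zero gives zero; the mean value is carried
    -- by the constant `(1 + δ) / 2`.
    by_cases hn : n = 0
    · simp [hn]
    · have : (n : ℂ) ≠ 0 := by exact_mod_cast hn
      field_simp
  · push_cast
    field_simp
    ring

/-- The Fourier coefficients of `x ↦ smoothFloor δ (x - a) - smoothFloor δ (x - b)`. -/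
def intervalCoeff (δ a b : ℝ) (n : ℤ) : ℂ :=
  if n = 0 then ((b - a : ℝ) : ℂ) else floorCoeff δ n * (addExp (n * -a) - addExp (n * -b))

lemma hasSum_smoothFloor_sub {δ : ℝ} (hδ : 0 < δ) (hδ1 : δ < 1) (a b x : ℝ) :
    HasSum (fun n : ℤ => intervalCoeff δ a b n * addExp (n * x))
      ((smoothFloor δ (x - a) - smoothFloor δ (x - b) : ℝ) : ℂ) := by
  have h := (hasSum_smoothFloor hδ hδ1 (x - a)).sub (hasSum_smoothFloor hδ hδ1 (x - b))
  have h0 := hasSum_ite_eq (0 : ℤ) (((b - a : ℝ) : ℂ))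
  have h2 := h0.add h
  convert! h2 using 1
  · funext n
    rw [sub_eq_add_neg x a, sub_eq_add_neg x b, mul_add, mul_add, addExp_add, addExp_add,
      intervalCoeff]
    by_cases hn : n = 0
    · simp [hn, addExp_zero]
    · simp only [hn, if_false]; ring
  · push_cast; ring

/-- Interpolation between the bounds `1 / |n|` and `1 / (δ n²)` through `min 1 t⁻¹ ≤ t ^ (-ε)`. The
extra power `|n| ^ (-ε)` makes the sum over all frequencies converge, at the price of only `δ ^
(-ε)`. -/
lemma norm_intervalCoeff_le {δ : ℝ} (hδ : 0 < δ) {ε : ℝ} (hε : 0 ≤ ε) (hε1 : ε ≤ 1) (a b : ℝ)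
    {n : ℤ} (hn : n ≠ 0) :
    ‖intervalCoeff δ a b n‖ ≤ 2 * δ ^ (-ε) * |(n : ℝ)| ^ (-(1 + ε)) := by
  have hn0 : 0 < |(n : ℝ)| := by positivity
  have h1 : ‖addExp (n * -a) - addExp (n * -b)‖ ≤ 2 := by
    refine (norm_sub_le _ _).trans ?_
    rw [norm_addExp, norm_addExp]; norm_num
  have hπ := Real.pi_gt_three
  have h2 : ‖floorCoeff δ n‖ ≤ |(n : ℝ)|⁻¹ * min 1 (δ * |(n : ℝ)|)⁻¹ := by
    have hnorm : ‖floorCoeff δ n‖ =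
        ‖addExp (n * (-δ)) - 1‖ / (4 * Real.pi ^ 2 * δ * |(n : ℝ)| ^ 2) := by
      rw [floorCoeff, norm_div]
      simp [abs_of_pos hδ, abs_of_pos Real.pi_pos]
    rw [hnorm, div_le_iff₀ (by positivity)]
    rcases min_choice 1 (δ * |(n : ℝ)|)⁻¹ with h | h <;> rw [h]
    · refine (norm_addExp_sub_one_le _).trans ?_
      rw [abs_mul, abs_neg, abs_of_pos hδ]
      have : |(n : ℝ)|⁻¹ * 1 * (4 * Real.pi ^ 2 * δ * |(n : ℝ)| ^ 2)
          = 2 * Real.pi * (|(n : ℝ)| * δ) * (2 * Real.pi) := by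
        field_simp; ring
      rw [this]
      exact le_mul_of_one_le_right (by positivity) (by linarith)
    · refine (norm_addExp_sub_one_le_two _).trans ?_
      have : |(n : ℝ)|⁻¹ * (δ * |(n : ℝ)|)⁻¹ * (4 * Real.pi ^ 2 * δ * |(n : ℝ)| ^ 2)
          = 4 * Real.pi ^ 2 := by
        field_simp
      rw [this]; nlinarith
  have h3 : min 1 (δ * |(n : ℝ)|)⁻¹ ≤ (δ * |(n : ℝ)|) ^ (-ε) := by
    set t := δ * |(n : ℝ)| with ht
    have ht0 : 0 < t := by positivity
    rcases le_total t 1 with h | h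
    · exact (min_le_left _ _).trans (Real.one_le_rpow_of_pos_of_le_one_of_nonpos ht0 h (by linarith))
    · refine (min_le_right _ _).trans ?_
      rw [← Real.rpow_neg_one]
      exact Real.rpow_le_rpow_of_exponent_le h (by linarith)
  rw [intervalCoeff, if_neg hn, norm_mul]
  calc ‖floorCoeff δ n‖ * ‖addExp (n * -a) - addExp (n * -b)‖
      ≤ (|(n : ℝ)|⁻¹ * (δ * |(n : ℝ)|) ^ (-ε)) * 2 := by
        refine mul_le_mul (h2.trans ?_) h1 (norm_nonneg _) (by positivity)
        exact mul_le_mul_of_nonneg_left h3 (by positivity)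
    _ = 2 * δ ^ (-ε) * |(n : ℝ)| ^ (-(1 + ε)) := by
        rw [Real.mul_rpow hδ.le hn0.le, neg_add, Real.rpow_add hn0, Real.rpow_neg_one]; ring

/-! ### Products of sums and integrals -/

lemma ENNReal.tsum_fin_prod {ι : Type*} {m : ℕ} (f : Fin m → ι → ENNReal) :
    ∑' h : Fin m → ι, ∏ j, f j (h j) = ∏ j, ∑' n, f j n := by
  induction m with
  | zero => simp
  | succ m ih =>
    rw [← (Fin.consEquiv fun _ : Fin (m + 1) => ι).tsum_eq, ENNReal.tsum_prod', Fin.prod_univ_succ,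
      ← ih, ← ENNReal.tsum_mul_right]
    refine tsum_congr fun n => ?_
    rw [← ENNReal.tsum_mul_left]
    refine tsum_congr fun h => ?_
    simp [Fin.prod_univ_succ, Fin.consEquiv]

lemma hasSum_fin_prod {ι : Type*} {m : ℕ} {f : Fin m → ι → ℂ} {s : Fin m → ℂ}
    (hf : ∀ j, HasSum (f j) (s j)) : HasSum (fun h : Fin m → ι => ∏ j, f j (h j)) (∏ j, s j) := by
  induction m with
  | zero =>
    simp only [Finset.univ_eq_empty, Finset.prod_empty]
    simp
  | succ m ih =>
    have h := ih (f := fun j => f j.succ) (s := fun j => s j.succ) fun j => hf j.succ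
    have h0 : Summable fun n => ‖f 0 n‖ := (hf 0).summable.norm
    have h1 : Summable fun h : Fin m → ι => ‖∏ j, f j.succ (h j)‖ := h.summable.norm
    have h2 : HasSum (fun x : ι × (Fin m → ι) => f 0 x.1 * ∏ j, f j.succ (x.2 j))
        (s 0 * ∏ j : Fin m, s j.succ) := by
      have h3 := summable_mul_of_summable_norm h0 h1
      have h4 := h3.hasSum
      rwa [← tsum_mul_tsum_of_summable_norm h0 h1, (hf 0).tsum_eq, h.tsum_eq] at h4
    refine (Fin.consEquiv fun _ : Fin (m + 1) => ι).hasSum_iff.1 ?_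
    rw [Fin.prod_univ_succ]
    have h3 : ((fun h : Fin (m + 1) → ι => ∏ j, f j (h j)) ∘ Fin.consEquiv fun _ => ι) =
        fun x : ι × (Fin m → ι) => f 0 x.1 * ∏ j, f j.succ (x.2 j) := by
      funext x
      simp [Fin.prod_univ_succ, Fin.consEquiv]
    rw [h3]
    exact h2

lemma lintegral_fin_prod {X : Type*} [MeasureSpace X] [SigmaFinite (volume : Measure X)]
    {f : X → ENNReal} (hf : Measurable f) (d : ℕ) :
    ∫⁻ x : Fin d → X, ∏ i, f (x i) = (∫⁻ x, f x) ^ d := by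
  induction d with
  | zero => simp [volume_pi]
  | succ d ih =>
    have h := (volume_preserving_piFinSuccAbove (fun _ : Fin (d + 1) => X) 0).symm
    rw [← h.lintegral_comp (by fun_prop)]
    simp only [Fin.prod_univ_succ]
    rw [pow_succ', ← ih, Measure.volume_eq_prod]
    have hg : Measurable fun x : Fin d → X => ∏ i, f (x i) :=
      Finset.measurable_prod _ fun i _ => hf.comp (measurable_pi_apply i)
    exact lintegral_prod_mul (μ := (volume : Measure X)) (ν := (volume : Measure (Fin d → X)))
      hf.aemeasurable hg.aemeasurable

/-! ### Geometric sums -/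

lemma norm_geom_addExp_le (θ : ℝ) (N : ℕ) :
    ‖∑ n ∈ Finset.range N, addExp θ ^ n‖ ≤ N := by
  refine (norm_sum_le _ _).trans ?_
  simp [norm_addExp]

lemma norm_addExp_sub_one_ge (θ : ℝ) : ‖(θ : UnitAddCircle)‖ ≤ ‖addExp θ - 1‖ := by
  have hθ : addExp θ = addExp (θ - round θ) := by
    conv_lhs => rw [show θ = (θ - round θ) + round θ by ring, addExp_add, addExp_int, mul_one]
  rw [hθ, UnitAddCircle.norm_eq, addExp_sub_one_eq]
  set u := θ - round θ with hu
  have hu2 : |u| ≤ 1 / 2 := abs_sub_round θ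
  have h1 : |Real.sin (Real.pi * u)| = Real.sin (Real.pi * |u|) := by
    have hnn : 0 ≤ Real.sin (Real.pi * |u|) := by
      refine Real.sin_nonneg_of_nonneg_of_le_pi (by positivity) ?_
      nlinarith [Real.pi_pos]
    rcases abs_choice u with h | h <;> rw [h] at hnn ⊢
    · exact abs_of_nonneg hnn
    · rw [← abs_of_nonneg hnn, mul_neg, Real.sin_neg, abs_neg]
  have h2 := Real.mul_le_sin (x := Real.pi * |u|) (by positivity) (by nlinarith [Real.pi_pos])
  have h3 : 2 / Real.pi * (Real.pi * |u|) = 2 * |u| := by field_simp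
  rw [h1]
  nlinarith [abs_nonneg u]

lemma norm_geom_addExp_mul_le (θ : ℝ) (N : ℕ) :
    ‖∑ n ∈ Finset.range N, addExp θ ^ n‖ * ‖(θ : UnitAddCircle)‖ ≤ 2 := by
  refine (mul_le_mul_of_nonneg_left (norm_addExp_sub_one_ge θ) (norm_nonneg _)).trans ?_
  rw [← norm_mul, geom_sum_mul, ← addExp_nat_mul]
  exact norm_addExp_sub_one_le_two _

/-- Geometric mean of the trivial bound `N`, with weight `ε`, and the bound `2 / ‖θ‖`, with weight
`1 - ε`. The exponent stays above `-1`, so the right-hand side is integrable in `θ`, and `N` enters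
only with a small power. -/
lemma enorm_geom_addExp_le {ε : ℝ} (hε : 0 < ε) (hε1 : ε < 1) (θ : ℝ) (N : ℕ) :
    ‖∑ n ∈ Finset.range N, addExp θ ^ n‖ₑ ≤
      ENNReal.ofReal (2 * (N : ℝ) ^ ε) * ‖(θ : UnitAddCircle)‖ₑ ^ (-(1 - ε)) := by
  set A := ‖∑ n ∈ Finset.range N, addExp θ ^ n‖ with hA
  set t := ‖(θ : UnitAddCircle)‖ with ht
  rcases Nat.eq_zero_or_pos N with hN | hN
  · subst hN; simp
  rcases (norm_nonneg (θ : UnitAddCircle)).eq_or_lt' with h0 | h0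
  -- For an integer `θ` the negative power of `0` is `⊤`, and `N ≥ 1` keeps the other factor
  -- non-zero.
  · have : ‖(θ : UnitAddCircle)‖ₑ = 0 := by
      rw [← ofReal_norm, h0, ENNReal.ofReal_zero]
    rw [this, ENNReal.zero_rpow_of_neg (by linarith), ENNReal.mul_top]
    · exact le_top
    · rw [Ne, ENNReal.ofReal_eq_zero, not_le]; positivity
  · rw [← ofReal_norm, ← ofReal_norm, ENNReal.ofReal_rpow_of_pos h0,
      ← ENNReal.ofReal_mul (by positivity)]
    refine ENNReal.ofReal_le_ofReal ?_
    rw [← hA, ← ht]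
    have hA0 : 0 ≤ A := norm_nonneg _
    have h1 : A ≤ N := norm_geom_addExp_le θ N
    have h2 : A ≤ 2 * t⁻¹ := by
      rw [← div_eq_mul_inv, le_div_iff₀ h0]; exact norm_geom_addExp_mul_le θ N
    calc A = A ^ ε * A ^ (1 - ε) := by
          rw [← Real.rpow_add_of_nonneg hA0 hε.le (by linarith)]; simp
      _ ≤ (N : ℝ) ^ ε * (2 * t⁻¹) ^ (1 - ε) := by
          gcongr
      _ = (N : ℝ) ^ ε * ((2 : ℝ) ^ (1 - ε) * t ^ (-(1 - ε))) := by
          rw [Real.mul_rpow (by norm_num) (by positivity), Real.inv_rpow h0.le,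
            ← Real.rpow_neg h0.le]
      _ ≤ (N : ℝ) ^ ε * (2 * t ^ (-(1 - ε))) := by
          gcongr
          calc (2 : ℝ) ^ (1 - ε) ≤ 2 ^ (1 : ℝ) :=
                Real.rpow_le_rpow_of_exponent_le (by norm_num) (by linarith)
            _ = 2 := Real.rpow_one 2
      _ = _ := by ring

/-! ### Integrability of negative powers of the distance to the nearest integer -/

lemma lintegral_Ioc_rpow_lt_top {ε : ℝ} (hε : 0 < ε) :
    ∫⁻ x in Ioc (0 : ℝ) 1, ENNReal.ofReal (x ^ (-(1 - ε))) < ⊤ := by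
  have h := (intervalIntegral.intervalIntegrable_rpow' (a := 0) (b := 1) (r := -(1 - ε))
    (by linarith)).1
  exact h.lintegral_lt_top

lemma lintegral_Ioc_one_sub_rpow_lt_top {ε : ℝ} (hε : 0 < ε) :
    ∫⁻ x in Ioc (0 : ℝ) 1, ENNReal.ofReal ((1 - x) ^ (-(1 - ε))) < ⊤ := by
  have h := (intervalIntegral.intervalIntegrable_rpow' (a := 0) (b := 1) (r := -(1 - ε))
    (by linarith)).comp_sub_left 1
  simp only [sub_zero, sub_self] at h
  exact h.symm.1.lintegral_lt_top

lemma lintegral_enorm_unitAddCircle_lt_top {ε : ℝ} (hε : 0 < ε) (hε1 : ε < 1) :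
    ∫⁻ θ : UnitAddCircle, ‖θ‖ₑ ^ (-(1 - ε)) < ⊤ := by
  rw [← UnitAddCircle.lintegral_preimage 0, zero_add]
  have h := ENNReal.add_lt_top.2 ⟨lintegral_Ioc_rpow_lt_top hε, lintegral_Ioc_one_sub_rpow_lt_top hε⟩
  rw [← lintegral_add_left (by fun_prop)] at h
  refine lt_of_le_of_lt ?_ h
  rw [← restrict_Ioo_eq_restrict_Ioc]
  refine setLIntegral_mono' measurableSet_Ioo fun x hx => ?_
  have hpos : 0 < ‖(x : UnitAddCircle)‖ := by
    rw [UnitAddCircle.norm_eq, abs_pos, sub_ne_zero]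
    intro hxr
    have h0 := hx.1
    have h1 := hx.2
    rw [hxr] at h0 h1
    have h0' : (0 : ℤ) < round x := by exact_mod_cast h0
    have h1' : round x < (1 : ℤ) := by exact_mod_cast h1
    omega
  rw [← ofReal_norm, ENNReal.ofReal_rpow_of_pos hpos]
  have key : ‖(x : UnitAddCircle)‖ = x ∨ ‖(x : UnitAddCircle)‖ = 1 - x := by
    rw [UnitAddCircle.norm_eq]
    have h1 := abs_sub_round x
    have h2 := abs_le.1 h1
    have h3 : (-1 : ℝ) < round x := by have := hx.1; linarith
    have h4 : (round x : ℝ) < 2 := by have := hx.2; linarith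
    have h3' : (-1 : ℤ) < round x := by exact_mod_cast h3
    have h4' : round x < (2 : ℤ) := by exact_mod_cast h4
    have h5 : round x = 0 ∨ round x = 1 := by omega
    rcases h5 with h5 | h5 <;> rw [h5]
    · left; simp [abs_of_pos hx.1]
    · right; rw [abs_sub_comm]; push_cast; exact abs_of_pos (by linarith [hx.2])
  rcases key with h | h <;> rw [h]
  · exact le_self_add
  · exact le_add_self

/-! ### A metric theorem on linear forms -/

/-- A continuous surjective homomorphism of compact groups carries normalised Haar measure to
normalised Haar measure. Surjectivity comes from dividing by one non-zero entry of `h`. -/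
lemma measurePreserving_torus_linear {d m : ℕ} {h : Fin m → ℤ} (hh : h ≠ 0) :
    MeasurePreserving
      (fun (a : Fin m → Fin d → UnitAddCircle) (i : Fin d) => ∑ j, h j • a j i) := by
  let F : (Fin m → Fin d → UnitAddCircle) →+ (Fin d → UnitAddCircle) :=
    { toFun := fun a i => ∑ j, h j • a j i
      map_zero' := by funext i; simp
      map_add' := fun a b => by funext i; simp [smul_add, Finset.sum_add_distrib] }
  have hcont : Continuous F := by
    change Continuous fun (a : Fin m → Fin d → UnitAddCircle) (i : Fin d) => ∑ j, h j • a j i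
    fun_prop
  have hsurj : Function.Surjective F := by
    intro b
    obtain ⟨j₀, hj₀⟩ := Function.ne_iff.1 hh
    choose c hc using fun i => QuotientAddGroup.mk_surjective (b i)
    refine ⟨fun j i => if j = j₀ then ((c i / h j₀ : ℝ) : UnitAddCircle) else 0, ?_⟩
    funext i
    change ∑ j, h j • (if j = j₀ then ((c i / h j₀ : ℝ) : UnitAddCircle) else 0) = b i
    rw [Finset.sum_eq_single j₀ (fun j _ hj => by simp [hj]) (by simp), if_pos rfl,
      ← AddCircle.coe_zsmul, ← hc i]
    congr 1
    have : (h j₀ : ℝ) ≠ 0 := by exact_mod_cast hj₀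
    rw [zsmul_eq_mul]
    field_simp
  have : SecondCountableTopology UnitAddCircle := inferInstance
  have : BorelSpace (Fin d → UnitAddCircle) := Pi.borelSpace
  have : BorelSpace (Fin m → Fin d → UnitAddCircle) := Pi.borelSpace
  have : (volume : Measure (Fin d → UnitAddCircle)).IsAddHaarMeasure := by
    rw [volume_pi]; infer_instance
  have : MeasurableAdd (Fin d → UnitAddCircle) := inferInstance
  have : SigmaFinite (volume : Measure (Fin d → UnitAddCircle)) := inferInstance
  have : (volume : Measure (Fin m → Fin d → UnitAddCircle)).IsAddHaarMeasure :=
    Measure.pi.isAddHaarMeasure _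
  exact AddMonoidHom.measurePreserving (f := F) hcont hsurj (by simp [volume_pi, Measure.pi_univ])

/-- The space of matrices is a countable union of unit cells, each of which maps to the torus in a
measure preserving way. -/
lemma ae_of_ae_torus {d m : ℕ} {p : (Fin m → Fin d → UnitAddCircle) → Prop}
    (hp : ∀ᵐ a, p a) : ∀ᵐ α : Fin m → Fin d → ℝ, p fun j i => (α j i : UnitAddCircle) := by
  have key : ∀ z : Fin m → Fin d → ℤ,
      ∀ᵐ α ∂((volume : Measure (Fin m → Fin d → ℝ)).restrict
        (Set.pi univ fun j => Set.pi univ fun i => Ioc (z j i : ℝ) (z j i + 1))),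
        p fun j i => (α j i : UnitAddCircle) := by
    intro z
    have h1 : ∀ j, MeasurePreserving (fun (x : Fin d → ℝ) (i : Fin d) => (x i : UnitAddCircle))
        (volume.restrict (Set.pi univ fun i => Ioc (z j i : ℝ) (z j i + 1))) volume := by
      intro j
      have := measurePreserving_pi (fun i : Fin d => volume.restrict (Ioc (z j i : ℝ) (z j i + 1)))
        (fun _ => (volume : Measure UnitAddCircle))
        (fun i => UnitAddCircle.measurePreserving_mk (z j i))
      rwa [← Measure.restrict_pi_pi] at this
    have h2 := measurePreserving_pi
      (fun j : Fin m => (volume : Measure (Fin d → ℝ)).restrict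
        (Set.pi univ fun i => Ioc (z j i : ℝ) (z j i + 1)))
      (fun _ => (volume : Measure (Fin d → UnitAddCircle))) h1
    rw [← Measure.restrict_pi_pi] at h2
    exact h2.quasiMeasurePreserving.ae hp
  have hU : (⋃ z : Fin m → Fin d → ℤ,
      (Set.pi univ fun j => Set.pi univ fun i => Ioc (z j i : ℝ) (z j i + 1))) = univ := by
    refine eq_univ_of_forall fun α => mem_iUnion.2 ⟨fun j i => ⌈α j i⌉ - 1, ?_⟩
    intro j _ i _
    have := Int.ceil_lt_add_one (α j i)
    have := Int.le_ceil (α j i)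
    constructor <;> push_cast <;> linarith
  have := (ae_restrict_iUnion_iff
    (fun z : Fin m → Fin d → ℤ =>
      (Set.pi univ fun j => Set.pi univ fun i => Ioc (z j i : ℝ) (z j i + 1)))
    (fun α : Fin m → Fin d → ℝ => p fun j i => (α j i : UnitAddCircle))).2 key
  rwa [hU, Measure.restrict_univ] at this

lemma tsum_int_rpow_lt_top {ε : ℝ} (hε : 0 < ε) :
    ∑' n : ℤ, ENNReal.ofReal ((max 1 |(n : ℝ)|) ^ (-(1 + ε))) < ⊤ := by
  have hs : Summable fun n : ℤ => (max 1 |(n : ℝ)|) ^ (-(1 + ε)) := by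
    have h := (Real.summable_abs_int_rpow (b := 1 + ε) (by linarith))
    have h0 := (hasSum_ite_eq (0 : ℤ) (1 : ℝ)).summable
    refine Summable.of_nonneg_of_le (fun n => by positivity) (fun n => ?_) (h.add h0)
    by_cases hn : n = 0
    · subst hn
      simp
      positivity
    · have : 1 ≤ |(n : ℝ)| := by exact_mod_cast Int.one_le_abs hn
      rw [max_eq_right this]
      simp [hn]
  rw [lt_top_iff_ne_top]
  exact hs.tsum_ofReal_ne_top

/-- For almost every system of linear forms, the values at the non-zero integer points do not come
close to integers too often. -/
theorem ae_tsum_linearForms_lt_top (d m : ℕ) {ε : ℝ} (hε : 0 < ε) (hε1 : ε < 1) :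
    ∀ᵐ α : Fin m → Fin d → ℝ, ∑' h : {h : Fin m → ℤ // h ≠ 0},
      (∏ j, ENNReal.ofReal ((max 1 |(h.1 j : ℝ)|) ^ (-(1 + ε)))) *
        ∏ i, ‖((∑ j, h.1 j * α j i : ℝ) : UnitAddCircle)‖ₑ ^ (-(1 - ε)) < ⊤ := by
  set w : (Fin m → ℤ) → ENNReal := fun h =>
    ∏ j, ENNReal.ofReal ((max 1 |(h j : ℝ)|) ^ (-(1 + ε))) with hw
  have hmeas : Measurable fun θ : UnitAddCircle => ‖θ‖ₑ ^ (-(1 - ε)) := by fun_prop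
  have hmeas2 : Measurable fun b : Fin d → UnitAddCircle => ∏ i, ‖b i‖ₑ ^ (-(1 - ε)) :=
    Finset.measurable_prod _ fun i _ => hmeas.comp (measurable_pi_apply i)
  have hlin : ∀ h : Fin m → ℤ, Measurable fun (a : Fin m → Fin d → UnitAddCircle) (i : Fin d) =>
      ∑ j, h j • a j i := fun h => Continuous.measurable (by fun_prop)
  let G : (Fin m → ℤ) → (Fin m → Fin d → UnitAddCircle) → ENNReal := fun h a =>
    ∏ i, ‖∑ j, h j • a j i‖ₑ ^ (-(1 - ε))
  have hG : ∀ h, Measurable (G h) := fun h => hmeas2.comp (hlin h)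
  have hwG : ∀ h, Measurable fun a => w h * G h a := fun h => (hG h).const_mul _
  -- Apart from its weight, the integral of a term does not depend on `h`; hence the integral of the
  -- series is finite as soon as the weights are summable.
  have h2 : ∀ h, h ≠ 0 → ∫⁻ a, w h * G h a =
      w h * (∫⁻ θ : UnitAddCircle, ‖θ‖ₑ ^ (-(1 - ε))) ^ d := by
    intro h hh
    rw [lintegral_const_mul _ (hG h), ← lintegral_fin_prod hmeas,
      ← (measurePreserving_torus_linear (d := d) hh).lintegral_comp hmeas2]
  have h1 : ∀ᵐ a, ∑' h : {h : Fin m → ℤ // h ≠ 0}, w h.1 * G h.1 a < ⊤ := by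
    refine ae_lt_top (Measurable.tsum fun h : {h : Fin m → ℤ // h ≠ 0} => hwG h.1) ?_
    rw [lintegral_tsum fun h : {h : Fin m → ℤ // h ≠ 0} => (hwG h.1).aemeasurable,
      tsum_congr fun h : {h : Fin m → ℤ // h ≠ 0} => h2 h.1 h.2, ENNReal.tsum_mul_right]
    refine ENNReal.mul_ne_top (ne_top_of_le_ne_top ?_
      (ENNReal.tsum_comp_le_tsum_of_injective Subtype.val_injective w))
      (ENNReal.pow_ne_top (lintegral_enorm_unitAddCircle_lt_top hε hε1).ne)
    rw [hw, ENNReal.tsum_fin_prod fun _ (n : ℤ) => ENNReal.ofReal ((max 1 |(n : ℝ)|) ^ (-(1 + ε)))]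
    exact ENNReal.prod_ne_top fun _ _ => (tsum_int_rpow_lt_top hε).ne
  filter_upwards [ae_of_ae_torus h1] with α hα
  refine lt_of_eq_of_lt (tsum_congr fun h => ?_) hα
  congr 1
  refine Finset.prod_congr rfl fun i _ => ?_
  congr 2
  simp only [← AddCircle.coe_zsmul, zsmul_eq_mul]
  exact map_sum (QuotientAddGroup.mk' (AddSubgroup.zmultiples (1 : ℝ))) _ _

/-! ### Discrepancy of linear forms in boxes -/

/-- The cube `∏ [aᵢ, aᵢ + N)` of integer points. -/
def intCube {d : ℕ} (a : Fin d → ℤ) (N : ℕ) : Finset (Fin d → ℤ) :=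
  Fintype.piFinset fun i => Finset.Ico (a i) (a i + N)

lemma mem_intCube {d : ℕ} {a : Fin d → ℤ} {N : ℕ} {n : Fin d → ℤ} :
    n ∈ intCube a N ↔ ∀ i, a i ≤ n i ∧ n i < a i + N := by
  simp [intCube]

lemma card_intCube {d : ℕ} (a : Fin d → ℤ) (N : ℕ) : (intCube a N).card = N ^ d := by
  simp [intCube]

/-- The real vector with the same entries as an integer vector. -/
def intVec {d : ℕ} (n : Fin d → ℤ) : Fin d → ℝ := fun i => n i

lemma linMap_apply {d m : ℕ} (α : Fin m → Fin d → ℝ) (x : Fin d → ℝ) (j : Fin m) :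
    linMap α x j = ∑ i, α j i * x i := by
  simp [linMap, Matrix.mulVec, dotProduct]

lemma sum_addExp_Ico (a : ℤ) (N : ℕ) (θ : ℝ) :
    ∑ k ∈ Finset.Ico a (a + N), addExp (k * θ) =
      addExp (a * θ) * ∑ n ∈ Finset.range N, addExp θ ^ n := by
  rw [Finset.mul_sum]
  refine Finset.sum_nbij' (fun k => (k - a).toNat) (fun n => a + n) ?_ ?_ ?_ ?_ ?_
  · intro k hk; simp only [Finset.mem_Ico, Finset.mem_range] at *; omega
  · intro k hk; simp only [Finset.mem_Ico, Finset.mem_range] at *; omega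
  · intro k hk; simp only [Finset.mem_Ico] at hk; omega
  · intro k hk; omega
  · intro k hk
    simp only [Finset.mem_Ico] at hk
    rw [← addExp_nat_mul, ← addExp_add]
    congr 1
    have : ((k - a).toNat : ℝ) = k - a := by
      have : (((k - a).toNat : ℤ) : ℝ) = ((k - a : ℤ) : ℝ) := by
        rw [Int.toNat_of_nonneg (by omega)]
      push_cast at this; exact this
    rw [this]; ring

lemma sum_intCube_addExp {d m : ℕ} (α : Fin m → Fin d → ℝ) (t : Fin m → ℝ) (a : Fin d → ℤ) (N : ℕ)
    (h : Fin m → ℤ) :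
    ∑ n ∈ intCube a N, ∏ j, addExp (h j * (t j - linMap α (intVec n) j)) =
      (∏ j, addExp (h j * t j)) *
        ∏ i, (addExp (a i * -(∑ j, h j * α j i)) *
          ∑ n ∈ Finset.range N, addExp (-(∑ j, h j * α j i)) ^ n) := by
  simp_rw [← sum_addExp_Ico]
  rw [Finset.prod_univ_sum, Finset.mul_sum]
  refine Finset.sum_congr rfl fun n _ => ?_
  rw [← addExp_sum, ← addExp_sum, ← addExp_sum, ← addExp_add]
  congr 1
  simp only [linMap_apply, intVec, mul_sub, Finset.sum_sub_distrib, Finset.mul_sum, mul_neg,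
    Finset.sum_neg_distrib]
  rw [sub_eq_add_neg, Finset.sum_comm]
  congr 2
  refine Finset.sum_congr rfl fun i _ => Finset.sum_congr rfl fun j _ => ?_
  ring

lemma enorm_sum_intCube_addExp_le {d m : ℕ} (α : Fin m → Fin d → ℝ) (t : Fin m → ℝ)
    (a : Fin d → ℤ) (N : ℕ) (h : Fin m → ℤ) {ε : ℝ} (hε : 0 < ε) (hε1 : ε < 1) :
    ‖∑ n ∈ intCube a N, ∏ j, addExp (h j * (t j - linMap α (intVec n) j))‖ₑ ≤
      ENNReal.ofReal (2 * (N : ℝ) ^ ε) ^ d *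
        ∏ i, ‖((∑ j, h j * α j i : ℝ) : UnitAddCircle)‖ₑ ^ (-(1 - ε)) := by
  have h1 : ∀ x, ‖addExp x‖ₑ = 1 := fun x => by
    rw [← ofReal_norm, norm_addExp, ENNReal.ofReal_one]
  have hprod : ∀ {n : ℕ} (f : Fin n → ℂ), ‖∏ j, f j‖ₑ = ∏ j, ‖f j‖ₑ := fun f => by
    simp only [← ofReal_norm, norm_prod]
    exact ENNReal.ofReal_prod_of_nonneg fun _ _ => norm_nonneg _
  rw [sum_intCube_addExp, enorm_mul, hprod, hprod]
  simp only [h1, Finset.prod_const_one, one_mul, enorm_mul]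
  calc ∏ i, ‖∑ n ∈ Finset.range N, addExp (-(∑ j, h j * α j i)) ^ n‖ₑ
      ≤ ∏ i : Fin d, (ENNReal.ofReal (2 * (N : ℝ) ^ ε) *
          ‖((∑ j, h j * α j i : ℝ) : UnitAddCircle)‖ₑ ^ (-(1 - ε))) := by
        refine Finset.prod_le_prod' fun i _ => ?_
        refine (enorm_geom_addExp_le hε hε1 _ N).trans (le_of_eq ?_)
        rw [AddCircle.coe_neg, enorm_neg]
    _ = _ := by rw [Finset.prod_mul_distrib]; simp

/-- The sum over non-zero frequencies that controls the discrepancy. -/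
def frequencySum {d m : ℕ} (α : Fin m → Fin d → ℝ) (ε : ℝ) : ENNReal :=
  ∑' h : {h : Fin m → ℤ // h ≠ 0},
    (∏ j, ENNReal.ofReal ((max 1 |(h.1 j : ℝ)|) ^ (-(1 + ε)))) *
      ∏ i, ‖((∑ j, h.1 j * α j i : ℝ) : UnitAddCircle)‖ₑ ^ (-(1 - ε))

/-- Includes `n = 0`, so that the weights multiply over all coordinates of a frequency vector. The
bound 2 on the length leaves room for intervals widened by `δ`. -/
lemma norm_intervalCoeff_le' {δ : ℝ} (hδ : 0 < δ) (hδ1 : δ < 1) {ε : ℝ} (hε : 0 ≤ ε) (hε1 : ε ≤ 1)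
    {p q : ℝ} (hpq : |q - p| ≤ 2) (n : ℤ) :
    ‖intervalCoeff δ p q n‖ ≤ 2 * δ ^ (-ε) * (max 1 |(n : ℝ)|) ^ (-(1 + ε)) := by
  by_cases hn : n = 0
  · subst hn
    have h1 : 1 ≤ δ ^ (-ε) := Real.one_le_rpow_of_pos_of_le_one_of_nonpos hδ hδ1.le (by linarith)
    simp only [intervalCoeff, if_true, Int.cast_zero, abs_zero]
    rw [max_eq_left zero_le_one, Real.one_rpow, mul_one, Complex.norm_real, Real.norm_eq_abs]
    linarith
  · have : 1 ≤ |(n : ℝ)| := by exact_mod_cast Int.one_le_abs hn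
    rw [max_eq_right this]
    exact norm_intervalCoeff_le hδ hε hε1 p q hn

/-- Expand the product into its `m`-dimensional Fourier series and sum over the cube termwise. The
frequency `0` gives the main term; the others are bounded by coefficient times exponential sum. -/
lemma enorm_sum_smoothFloor_sub_le {d m : ℕ} (α : Fin m → Fin d → ℝ) {δ : ℝ} (hδ : 0 < δ)
    (hδ1 : δ < 1) {ε : ℝ} (hε : 0 < ε) (hε1 : ε < 1) {p q : Fin m → ℝ}
    (hpq : ∀ j, |q j - p j| ≤ 2) (t : Fin m → ℝ) (a : Fin d → ℤ) (N : ℕ) :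
    ‖∑ n ∈ intCube a N, ∏ j, (smoothFloor δ (t j - linMap α (intVec n) j - p j) -
        smoothFloor δ (t j - linMap α (intVec n) j - q j)) - N ^ d * ∏ j, (q j - p j)‖ₑ ≤
      ENNReal.ofReal ((2 * δ ^ (-ε)) ^ m * (2 * (N : ℝ) ^ ε) ^ d) * frequencySum α ε := by
  set c : Fin m → ℤ → ℂ := fun j => intervalCoeff δ (p j) (q j) with hc
  set F : (Fin m → ℤ) → ℂ := fun h =>
    (∏ j, c j (h j)) * ∑ n ∈ intCube a N, ∏ j, addExp (h j * (t j - linMap α (intVec n) j)) with hF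
  set total : ℂ := ∑ n ∈ intCube a N,
    ∏ j, ((smoothFloor δ (t j - linMap α (intVec n) j - p j) -
        smoothFloor δ (t j - linMap α (intVec n) j - q j) : ℝ) : ℂ) with htotal
  have hsum : HasSum F total := by
    have h1 := hasSum_sum (s := intCube a N) fun n _ => hasSum_fin_prod fun j =>
      hasSum_smoothFloor_sub hδ hδ1 (p j) (q j) (t j - linMap α (intVec n) j)
    convert! h1 using 1
    funext h
    rw [hF]
    simp only [Finset.mul_sum, Finset.prod_mul_distrib, hc]
  have hF0 : F 0 = N ^ d * ∏ j, ((q j - p j : ℝ) : ℂ) := by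
    simp only [hF, hc, intervalCoeff, Pi.zero_apply, if_true, Int.cast_zero, zero_mul, addExp_zero,
      Finset.prod_const_one, Finset.sum_const, card_intCube]
    simp [mul_comm]
  have h2 := hasSum_ite_sub_hasSum hsum 0
  have h3 : ‖total - F 0‖ₑ ≤ ∑' h : {h : Fin m → ℤ // h ≠ 0}, ‖F h.1‖ₑ := by
    rw [← h2.tsum_eq]
    refine enorm_tsum_le_tsum_enorm.trans (le_of_eq ?_)
    refine Eq.trans ?_ (tsum_subtype {h : Fin m → ℤ | h ≠ 0} fun h => ‖F h‖ₑ).symm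
    refine tsum_congr fun h => ?_
    by_cases hh : h = 0 <;> simp [hh, Set.indicator]
  have h4 : ∀ h, ‖F h‖ₑ ≤ ENNReal.ofReal ((2 * δ ^ (-ε)) ^ m * (2 * (N : ℝ) ^ ε) ^ d) *
      ((∏ j, ENNReal.ofReal ((max 1 |(h j : ℝ)|) ^ (-(1 + ε)))) *
      ∏ i, ‖((∑ j, h j * α j i : ℝ) : UnitAddCircle)‖ₑ ^ (-(1 - ε))) := by
    intro h
    rw [hF]
    simp only [enorm_mul]
    have h5 : ‖∏ j, c j (h j)‖ₑ ≤ ENNReal.ofReal ((2 * δ ^ (-ε)) ^ m) *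
        ∏ j, ENNReal.ofReal ((max 1 |(h j : ℝ)|) ^ (-(1 + ε))) := by
      rw [← ENNReal.ofReal_prod_of_nonneg fun _ _ => by positivity,
        ← ENNReal.ofReal_mul (by positivity), ← ofReal_norm, norm_prod]
      refine ENNReal.ofReal_le_ofReal ?_
      calc ∏ j, ‖c j (h j)‖ ≤ ∏ j, (2 * δ ^ (-ε) * (max 1 |(h j : ℝ)|) ^ (-(1 + ε))) :=
            Finset.prod_le_prod (fun _ _ => norm_nonneg _) fun j _ =>
              norm_intervalCoeff_le' hδ hδ1 hε.le hε1.le (hpq j) _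
        _ = _ := by rw [Finset.prod_mul_distrib]; simp
    refine (mul_le_mul' h5 (enorm_sum_intCube_addExp_le α t a N h hε hε1)).trans (le_of_eq ?_)
    rw [ENNReal.ofReal_mul (p := (2 * δ ^ (-ε)) ^ m) (by positivity),
      ENNReal.ofReal_pow (p := 2 * (N : ℝ) ^ ε) (by positivity)]
    ring
  have h5 : ‖total - F 0‖ₑ ≤
      ENNReal.ofReal ((2 * δ ^ (-ε)) ^ m * (2 * (N : ℝ) ^ ε) ^ d) * frequencySum α ε := by
    refine h3.trans ?_
    rw [frequencySum, ← ENNReal.tsum_mul_left]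
    exact ENNReal.tsum_le_tsum fun h => h4 h.1
  refine le_of_eq_of_le ?_ h5
  rw [hF0, htotal, ← ofReal_norm, ← ofReal_norm]
  congr 1
  rw [← Complex.norm_real]
  push_cast
  rfl

lemma floor_sub_floor_eq_ite {a b x : ℝ} (ha : 0 ≤ a) (hab : a ≤ b) (hb : b ≤ 1) :
    (⌊x - a⌋ - ⌊x - b⌋ : ℝ) = if Int.fract x ∈ Ico a b then 1 else 0 := by
  have h0 := Int.fract_nonneg x
  have h1 := Int.fract_lt_one x
  have hx := Int.self_sub_floor x
  have key : ∀ c, 0 ≤ c → c ≤ 1 →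
      (⌊x - c⌋ : ℝ) = if c ≤ Int.fract x then (⌊x⌋ : ℝ) else ⌊x⌋ - 1 := by
    intro c hc0 hc1
    split_ifs with h
    · have : ⌊x - c⌋ = ⌊x⌋ := by rw [Int.floor_eq_iff]; constructor <;> linarith
      rw [this]
    · have : ⌊x - c⌋ = ⌊x⌋ - 1 := by
        rw [Int.floor_eq_iff]; push_cast; constructor <;> linarith
      rw [this]; push_cast; ring
  rw [key a ha (hab.trans hb), key b (ha.trans hab) hb]
  simp only [Set.mem_Ico]
  split_ifs <;> grind

lemma abs_prod_sub_prod_le {ι : Type*} (s : Finset ι) {x y : ι → ℝ} {δ : ℝ}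
    (hx : ∀ i ∈ s, |x i| ≤ 2) (hy : ∀ i ∈ s, |y i| ≤ 2) (hxy : ∀ i ∈ s, |x i - y i| ≤ δ) :
    |∏ i ∈ s, x i - ∏ i ∈ s, y i| ≤ s.card * 2 ^ s.card * δ := by
  classical
  induction s using Finset.induction_on with
  | empty => simp
  | insert a s ha ih =>
    have ih := ih (fun i hi => hx i (Finset.mem_insert_of_mem hi))
      (fun i hi => hy i (Finset.mem_insert_of_mem hi))
      (fun i hi => hxy i (Finset.mem_insert_of_mem hi))
    rw [Finset.prod_insert ha, Finset.prod_insert ha, Finset.card_insert_of_notMem ha]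
    have hxa := hx a (Finset.mem_insert_self a s)
    have hxya := hxy a (Finset.mem_insert_self a s)
    have hδ : 0 ≤ δ := (abs_nonneg _).trans hxya
    have hprod : |∏ i ∈ s, y i| ≤ 2 ^ s.card := by
      rw [Finset.abs_prod, ← Finset.prod_const]
      exact Finset.prod_le_prod (fun _ _ => abs_nonneg _)
        fun i hi => hy i (Finset.mem_insert_of_mem hi)
    have heq : x a * ∏ i ∈ s, x i - y a * ∏ i ∈ s, y i =
        x a * (∏ i ∈ s, x i - ∏ i ∈ s, y i) + (x a - y a) * ∏ i ∈ s, y i := by ring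
    rw [heq]
    refine (abs_add_le _ _).trans ?_
    rw [abs_mul, abs_mul]
    have h1 := mul_le_mul hxa ih (abs_nonneg _) (by norm_num)
    have h2 := mul_le_mul hxya hprod (abs_nonneg _) hδ
    push_cast
    have h3 : (0 : ℝ) ≤ 2 ^ s.card * δ := by positivity
    rw [pow_succ]
    nlinarith

open Classical in
/-- In every cube of side `N` the number of integer points `n` for which the fractional part of
`t - L n` lies in `G` is `ξ Nᵈ`, up to an error of size `C N ^ (d - 3 / 2)`. -/
def HasSmallDiscrepancy {d m : ℕ} (α : Fin m → Fin d → ℝ) (G : Set (Fin m → ℝ)) (ξ C : ℝ) : Prop :=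
  ∀ (t : Fin m → ℝ) (a : Fin d → ℤ) (N : ℕ), 1 ≤ N →
    |(((intCube a N).filter fun n =>
        (fun j => Int.fract (t j - linMap α (intVec n) j)) ∈ G).card : ℝ) - ξ * N ^ d| ≤
      C * (N ^ (d - 2) * √N)

open Classical in
lemma card_filter_eq_sum_floor {d m : ℕ} (α : Fin m → Fin d → ℝ) {p q : Fin m → ℝ}
    (hpq : ∀ j, 0 ≤ p j ∧ p j ≤ q j ∧ q j ≤ 1) (t : Fin m → ℝ) (s : Finset (Fin d → ℤ)) :
    ((s.filter fun n => (fun j => Int.fract (t j - linMap α (intVec n) j)) ∈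
        Set.pi univ fun j => Ico (p j) (q j)).card : ℝ) =
      ∑ n ∈ s, ∏ j, ((⌊t j - linMap α (intVec n) j - p j⌋ : ℝ) -
        ⌊t j - linMap α (intVec n) j - q j⌋) := by
  rw [Finset.card_filter]
  push_cast
  refine Finset.sum_congr rfl fun n _ => ?_
  rw [Finset.prod_congr rfl fun j _ =>
    floor_sub_floor_eq_ite (hpq j).1 (hpq j).2.1 (hpq j).2.2, Finset.prod_ite_zero]
  simp [Set.mem_pi]

/-- With `δ = (2N)⁻²` the powers of `N` combine to at most `(2N) ^ (ε (d + 2m))`, and `ε` is chosen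
to make this `√(2N)`. The 2 in `2N` keeps `δ < 1` when `N = 1`. -/
lemma abs_sum_smoothFloor_sub_le {d m : ℕ} (hd : 2 ≤ d) (α : Fin m → Fin d → ℝ)
    (hα : frequencySum α (1 / (2 * (d + 2 * m))) < ⊤) {N : ℕ} (hN : 1 ≤ N) {p q : Fin m → ℝ}
    (hpq : ∀ j, |q j - p j| ≤ 2) (t : Fin m → ℝ) (a : Fin d → ℤ) :
    |∑ n ∈ intCube a N, ∏ j, (smoothFloor (((2 * N : ℝ) ^ 2)⁻¹) (t j - linMap α (intVec n) j - p j) -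
        smoothFloor (((2 * N : ℝ) ^ 2)⁻¹) (t j - linMap α (intVec n) j - q j)) -
          N ^ d * ∏ j, (q j - p j)| ≤
      2 ^ (m + d + 1) * √N * (frequencySum α (1 / (2 * (d + 2 * m)))).toReal := by
  set ε : ℝ := 1 / (2 * (d + 2 * m)) with hε
  have hd' : (2 : ℝ) ≤ d := by exact_mod_cast hd
  have hm' : (0 : ℝ) ≤ m := Nat.cast_nonneg m
  have hN' : (1 : ℝ) ≤ N := by exact_mod_cast hN
  have hε0 : 0 < ε := by positivity
  have hε1 : ε < 1 := by rw [hε, div_lt_one (by positivity)]; linarith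
  set B : ℝ := 2 * N with hB
  have hB1 : 1 < B := by linarith
  have hB0 : 0 < B := by linarith
  have hδ0 : 0 < (B ^ 2)⁻¹ := by positivity
  have hδ1 : (B ^ 2)⁻¹ < 1 := inv_lt_one_of_one_lt₀ (by nlinarith)
  have h := enorm_sum_smoothFloor_sub_le α hδ0 hδ1 hε0 hε1 hpq t a N
  have hK : (2 * (B ^ 2)⁻¹ ^ (-ε)) ^ m * (2 * (N : ℝ) ^ ε) ^ d ≤ 2 ^ (m + d + 1) * √N := by
    have h1 : (B ^ 2)⁻¹ ^ (-ε) = B ^ (2 * ε) := by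
      rw [Real.inv_rpow (by positivity), Real.rpow_neg (by positivity), inv_inv,
        ← Real.rpow_natCast, ← Real.rpow_mul hB0.le]
      norm_num
    have h2 : (N : ℝ) ^ ε ≤ B ^ ε := Real.rpow_le_rpow (by positivity) (by linarith) hε0.le
    have h3 : √B ≤ 2 * √N := by
      rw [hB, Real.sqrt_le_left (by positivity), mul_pow, Real.sq_sqrt (by positivity)]
      linarith
    calc (2 * (B ^ 2)⁻¹ ^ (-ε)) ^ m * (2 * (N : ℝ) ^ ε) ^ d
        ≤ (2 * B ^ (2 * ε)) ^ m * (2 * B ^ ε) ^ d := by rw [h1]; gcongr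
      _ = 2 ^ (m + d) * B ^ (ε * (d + 2 * m)) := by
          rw [mul_pow, mul_pow, ← Real.rpow_mul_natCast hB0.le, ← Real.rpow_mul_natCast hB0.le,
            pow_add, show ε * (d + 2 * m) = 2 * ε * m + ε * d by ring, Real.rpow_add hB0]
          ring
      _ = 2 ^ (m + d) * √B := by
          rw [Real.sqrt_eq_rpow, hε]
          congr 2
          have : (d : ℝ) + 2 * m ≠ 0 := by positivity
          field_simp
      _ ≤ 2 ^ (m + d) * (2 * √N) := by gcongr
      _ = 2 ^ (m + d + 1) * √N := by ring
  rw [← Real.norm_eq_abs, ← toReal_enorm]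
  have h4 := ENNReal.toReal_mono (ENNReal.mul_ne_top ENNReal.ofReal_ne_top hα.ne) h
  refine h4.trans ?_
  rw [ENNReal.toReal_mul, ENNReal.toReal_ofReal (by positivity)]
  gcongr

theorem HasSmallDiscrepancy.box {d m : ℕ} (hd : 2 ≤ d) {α : Fin m → Fin d → ℝ}
    (hα : frequencySum α (1 / (2 * (d + 2 * m))) < ⊤) {p q : Fin m → ℝ}
    (hpq : ∀ j, 0 ≤ p j ∧ p j ≤ q j ∧ q j ≤ 1) :
    HasSmallDiscrepancy α (Set.pi univ fun j => Ico (p j) (q j)) (∏ j, (q j - p j))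
      (2 ^ (m + d + 1) * (frequencySum α (1 / (2 * (d + 2 * m)))).toReal + m * 2 ^ m + 1) := by
  intro t a N hN
  rw [card_filter_eq_sum_floor α hpq]
  have hN' : (1 : ℝ) ≤ N := by exact_mod_cast hN
  set T := (frequencySum α (1 / (2 * (d + 2 * m)))).toReal with hT
  have hT0 : 0 ≤ T := ENNReal.toReal_nonneg
  set δ : ℝ := ((2 * N : ℝ) ^ 2)⁻¹ with hδ
  have hδ0 : 0 < δ := by positivity
  have hδ1 : 2 * δ ≤ 1 := by
    rw [hδ, ← div_eq_mul_inv, div_le_one (by positivity)]; nlinarith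
  have hNδ : (N : ℝ) ^ d * (2 * δ) ≤ N ^ (d - 2) := by
    obtain ⟨e, rfl⟩ := Nat.exists_eq_add_of_le hd
    rw [hδ, ← div_eq_mul_inv, ← mul_div_assoc, div_le_iff₀ (by positivity), Nat.add_sub_cancel_left]
    have : (0 : ℝ) ≤ N ^ e * N ^ 2 := by positivity
    rw [pow_add]; nlinarith
  have hsqrt : 1 ≤ √(N : ℝ) := Real.one_le_sqrt.2 hN'
  have hpow : (1 : ℝ) ≤ N ^ (d - 2) := one_le_pow₀ hN'
  have hNpow : (0 : ℝ) ≤ N ^ d := by positivity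
  have hE : 2 ^ (m + d + 1) * √N * T ≤ 2 ^ (m + d + 1) * T * (N ^ (d - 2) * √N) := by
    have : √(N : ℝ) ≤ N ^ (d - 2) * √N := le_mul_of_one_le_left (by positivity) hpow
    calc (2 : ℝ) ^ (m + d + 1) * √N * T = 2 ^ (m + d + 1) * T * √N := by ring
      _ ≤ _ := by gcongr
  have hD : (N : ℝ) ^ (d - 2) ≤ N ^ (d - 2) * √N := le_mul_of_one_le_right (by positivity) hsqrt
  have hle1 : ∀ j, 0 ≤ q j - p j ∧ q j - p j ≤ 1 := fun j => by
    have := hpq j; constructor <;> linarith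
  rw [abs_le]
  constructor
  · rw [neg_le_sub_iff_le_add]
    -- The lower bound shrinks each side by `δ`, and its factors are non-negative only if the side
    -- is at least `2δ`. A box with a shorter side has volume at most `2δ`, so its main term is
    -- already within the error.
    by_cases hsmall : ∃ j, q j - p j < 2 * δ
    · obtain ⟨j, hj⟩ := hsmall
      have h1 : ∏ j, (q j - p j) ≤ 2 * δ := by
        rw [← Finset.mul_prod_erase _ _ (Finset.mem_univ j)]
        have := Finset.prod_le_one (s := Finset.univ.erase j) (f := fun j => q j - p j)
          (fun i _ => (hle1 i).1) (fun i _ => (hle1 i).2)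
        have h0 := Finset.prod_nonneg (s := Finset.univ.erase j) (f := fun j => q j - p j)
          (fun i _ => (hle1 i).1)
        nlinarith [(hle1 j).1]
      have h2 : (0 : ℝ) ≤ ∑ n ∈ intCube a N, ∏ j, ((⌊t j - linMap α (intVec n) j - p j⌋ : ℝ) -
          ⌊t j - linMap α (intVec n) j - q j⌋) := by
        refine Finset.sum_nonneg fun n _ => Finset.prod_nonneg fun j _ => ?_
        rw [sub_nonneg]
        exact_mod_cast Int.floor_le_floor (by linarith [(hle1 j).1])
      have h3 : (∏ j, (q j - p j)) * (N : ℝ) ^ d ≤ N ^ (d - 2) := by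
        refine le_trans ?_ hNδ
        rw [mul_comm]; gcongr
      have h4 : (0 : ℝ) ≤ 2 ^ (m + d + 1) * T * (N ^ (d - 2) * √N) := by positivity
      have h5 : (0 : ℝ) ≤ m * 2 ^ m * (N ^ (d - 2) * √N) := by positivity
      linarith
    · push Not at hsmall
      have h1 := (abs_le.1 (abs_sum_smoothFloor_sub_le hd α hα hN (p := p) (q := fun j => q j - δ)
        (fun j => by
          have := hle1 j; have := hsmall j
          rw [abs_le]; constructor <;> linarith) t a)).1
      have h2 : ∑ n ∈ intCube a N, ∏ j, (smoothFloor δ (t j - linMap α (intVec n) j - p j) -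
          smoothFloor δ (t j - linMap α (intVec n) j - (q j - δ))) ≤
          ∑ n ∈ intCube a N, ∏ j, ((⌊t j - linMap α (intVec n) j - p j⌋ : ℝ) -
          ⌊t j - linMap α (intVec n) j - q j⌋) := by
        refine Finset.sum_le_sum fun n _ => Finset.prod_le_prod (fun j _ => ?_) fun j _ => ?_
        · have h3 := le_smoothFloor hδ0 (t j - linMap α (intVec n) j - p j)
          have h4 := smoothFloor_le (δ := δ) (t j - linMap α (intVec n) j - (q j - δ))
          have h5 : (⌊t j - linMap α (intVec n) j - (q j - δ)⌋ : ℝ) ≤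
              ⌊t j - linMap α (intVec n) j - p j - δ⌋ := by
            exact_mod_cast Int.floor_le_floor (by linarith [hsmall j])
          linarith
        · have h3 := smoothFloor_le (δ := δ) (t j - linMap α (intVec n) j - p j)
          have h4 := le_smoothFloor hδ0 (t j - linMap α (intVec n) j - (q j - δ))
          rw [show t j - linMap α (intVec n) j - (q j - δ) - δ = t j - linMap α (intVec n) j - q j
            by ring] at h4
          linarith
      have h3 := abs_prod_sub_prod_le Finset.univ (x := fun j => q j - p j)
        (y := fun j => q j - δ - p j) (δ := δ)
        (fun j _ => by have := hle1 j; rw [abs_le]; constructor <;> linarith)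
        (fun j _ => by have := hle1 j; rw [abs_le]; constructor <;> linarith)
        (fun j _ => by rw [show q j - p j - (q j - δ - p j) = δ by ring, abs_of_pos hδ0])
      rw [Finset.card_univ, Fintype.card_fin] at h3
      have h4 := mul_le_mul_of_nonneg_left ((abs_le.1 h3).2) hNpow
      have h5 : (N : ℝ) ^ d * (m * 2 ^ m * δ) ≤ m * 2 ^ m * (N ^ (d - 2) * √N) := by
        calc (N : ℝ) ^ d * (m * 2 ^ m * δ) ≤ m * 2 ^ m * ((N : ℝ) ^ d * (2 * δ)) := by
              have : (0 : ℝ) ≤ (N : ℝ) ^ d * (m * 2 ^ m * δ) := by positivity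
              linarith
          _ ≤ m * 2 ^ m * (N ^ (d - 2) * √N) :=
              mul_le_mul_of_nonneg_left (hNδ.trans hD) (by positivity)
      have h6 : (0 : ℝ) ≤ N ^ (d - 2) * √N := by positivity
      linarith
  · rw [sub_le_iff_le_add]
    have h1 := (abs_le.1 (abs_sum_smoothFloor_sub_le hd α hα hN (p := fun j => p j - δ) (q := q)
      (fun j => by
        have := hle1 j
        rw [abs_le]; constructor <;> linarith) t a)).2
    have h2 : ∑ n ∈ intCube a N, ∏ j, ((⌊t j - linMap α (intVec n) j - p j⌋ : ℝ) -
        ⌊t j - linMap α (intVec n) j - q j⌋) ≤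
        ∑ n ∈ intCube a N, ∏ j, (smoothFloor δ (t j - linMap α (intVec n) j - (p j - δ)) -
        smoothFloor δ (t j - linMap α (intVec n) j - q j)) := by
      refine Finset.sum_le_sum fun n _ => Finset.prod_le_prod (fun j _ => ?_) fun j _ => ?_
      · rw [sub_nonneg]
        exact_mod_cast Int.floor_le_floor (by linarith [(hle1 j).1])
      · have h3 := smoothFloor_le (δ := δ) (t j - linMap α (intVec n) j - q j)
        have h4 := le_smoothFloor hδ0 (t j - linMap α (intVec n) j - (p j - δ))
        rw [show t j - linMap α (intVec n) j - (p j - δ) - δ = t j - linMap α (intVec n) j - p j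
          by ring] at h4
        linarith
    have h3 := abs_prod_sub_prod_le Finset.univ (x := fun j => q j - (p j - δ))
      (y := fun j => q j - p j) (δ := δ)
      (fun j _ => by have := hle1 j; rw [abs_le]; constructor <;> linarith)
      (fun j _ => by have := hle1 j; rw [abs_le]; constructor <;> linarith)
      (fun j _ => by rw [show q j - (p j - δ) - (q j - p j) = δ by ring, abs_of_pos hδ0])
    rw [Finset.card_univ, Fintype.card_fin] at h3
    have h4 := mul_le_mul_of_nonneg_left ((abs_le.1 h3).2) hNpow
    have h5 : (N : ℝ) ^ d * (m * 2 ^ m * δ) ≤ m * 2 ^ m * (N ^ (d - 2) * √N) := by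
      calc (N : ℝ) ^ d * (m * 2 ^ m * δ) ≤ m * 2 ^ m * ((N : ℝ) ^ d * (2 * δ)) := by
            have : (0 : ℝ) ≤ (N : ℝ) ^ d * (m * 2 ^ m * δ) := by positivity
            linarith
        _ ≤ m * 2 ^ m * (N ^ (d - 2) * √N) :=
              mul_le_mul_of_nonneg_left (hNδ.trans hD) (by positivity)
    have h6 : (0 : ℝ) ≤ N ^ (d - 2) * √N := by positivity
    linarith

/-! ### An isoperimetric inequality in cubes -/

open Classical in
/-- The points of `H` that have a neighbour outside `H`. -/
def latticeBoundary {d : ℕ} (H : Finset (Fin d → ℤ)) : Finset (Fin d → ℤ) :=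
  H.filter fun n => ∃ n', n' ∉ H ∧ ∀ i, |n i - n' i| ≤ 1

lemma exists_int_boundary {P : ℤ → Prop} {u v : ℤ} (hu : P u) (hv : ¬ P v) :
    ∃ c, min u v ≤ c ∧ c ≤ max u v ∧ P c ∧ ∃ c', ¬ P c' ∧ |c - c'| ≤ 1 := by
  by_contra! hcon
  have hstep : ∀ c, min u v ≤ c → c ≤ max u v → P c → ∀ c', |c - c'| ≤ 1 → P c' := by
    intro c h1 h2 h3 c' h4
    by_contra h5
    exact absurd h4 (not_le.2 (hcon c h1 h2 h3 c' h5))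
  rcases le_total u v with h | h
  · refine hv (Int.leInduction (motive := fun w _ => w ≤ v → P w) (fun _ => hu)
      (fun w hw ih hwv => ?_) v h le_rfl)
    refine hstep w ?_ ?_ (ih (by omega)) _ (by simp)
    · rw [min_eq_left h]; exact hw
    · rw [max_eq_right h]; omega
  · refine hv (Int.leInductionDown (motive := fun w _ => v ≤ w → P w) (fun _ => hu)
      (fun w hw ih hwv => ?_) v h le_rfl)
    refine hstep w ?_ ?_ (ih (by omega)) _ (by simp)
    · rw [min_eq_right h]; omega
    · rw [max_eq_left h]; exact hw

-- Walk from `x` to `y`, changing the coordinates one after another. The walk leaves `H` along some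
-- coordinate `i`; there the earlier coordinates are already those of `y` and the later ones still
-- those of `x`.
open Classical in
lemma exists_boundary_on_path {d : ℕ} {H : Finset (Fin d → ℤ)} {a : Fin d → ℤ} {N : ℕ}
    {x y : Fin d → ℤ} (hx : x ∈ H ∩ intCube a N) (hy : y ∈ intCube a N \ H) :
    ∃ (i : Fin d) (b : Fin d → ℤ), b ∈ latticeBoundary H ∩ intCube a N ∧
      (∀ l, l < i → b l = y l) ∧ ∀ l, i < l → b l = x l := by
  rw [Finset.mem_inter] at hx
  rw [Finset.mem_sdiff] at hy
  set z : ℕ → Fin d → ℤ := fun k l => if l.1 < k then y l else x l with hz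
  have hz0 : z 0 = x := by funext l; simp [hz]
  have hzd : z d = y := by funext l; simp [hz]
  obtain ⟨k, hkd, hk1, hk2⟩ : ∃ k, k < d ∧ z k ∈ H ∧ z (k + 1) ∉ H := by
    by_contra! hcon
    have : ∀ k, k ≤ d → z k ∈ H := by
      intro k
      induction k with
      | zero => intro _; rw [hz0]; exact hx.1
      | succ k ih => intro hk; exact hcon k (by omega) (ih (by omega))
    exact hy.2 (hzd ▸ this d le_rfl)
  set i : Fin d := ⟨k, hkd⟩ with hi
  have hzk : Function.update (z k) i (x i) = z k := by
    rw [Function.update_eq_self_iff]; simp [hz, hi]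
  have hzk1 : Function.update (z k) i (y i) = z (k + 1) := by
    funext l
    rcases eq_or_ne l i with rfl | hl
    · simp [hz, hi]
    · have : l.1 ≠ k := fun h => hl (Fin.ext h)
      simp only [Function.update_of_ne hl, hz]
      congr 1
      simp only [eq_iff_iff]; omega
  obtain ⟨c, hc1, hc2, hc3, c', hc4, hc5⟩ := exists_int_boundary
    (P := fun c => Function.update (z k) i c ∈ H) (u := x i) (v := y i)
    (by rw [hzk]; exact hk1) (by rw [hzk1]; exact hk2)
  refine ⟨i, Function.update (z k) i c, ?_, fun l hl => ?_, fun l hl => ?_⟩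
  · rw [Finset.mem_inter, latticeBoundary, Finset.mem_filter]
    refine ⟨⟨hc3, Function.update (z k) i c', hc4, fun l => ?_⟩, ?_⟩
    · rcases eq_or_ne l i with rfl | hl
      · simpa using hc5
      · simp [Function.update_of_ne hl]
    · rw [mem_intCube]
      have hx' := mem_intCube.1 hx.2
      have hy' := mem_intCube.1 hy.1
      intro l
      rcases eq_or_ne l i with rfl | hl
      · rw [Function.update_self]
        have := hx' i; have := hy' i
        exact ⟨le_trans (le_min (by omega) (by omega)) hc1,
          lt_of_le_of_lt hc2 (max_lt (by omega) (by omega))⟩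
      · rw [Function.update_of_ne hl]
        simp only [hz]
        split_ifs
        · exact hy' l
        · exact hx' l
  · rw [Function.update_of_ne hl.ne]
    have : l.1 < k := hl
    simp [hz, this]
  · rw [Function.update_of_ne hl.ne']
    have : ¬ l.1 < k := not_lt.2 (le_of_lt hl)
    simp [hz, this]

-- Canonical paths: a pair `(x, y)` is recovered from the direction `i` and the boundary point `b`
-- on its path, together with what `b` has lost, namely `x l` for `l ≤ i`, `y l` for `l > i`, and `y
-- i`. The lost data take `N ^ d * N` values.
open Classical in
lemma card_inter_mul_card_sdiff_le {d : ℕ} (hd : 0 < d) (H : Finset (Fin d → ℤ)) (a : Fin d → ℤ) (N : ℕ) :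
    (H ∩ intCube a N).card * (intCube a N \ H).card ≤
      d * N ^ (d + 1) * (latticeBoundary H ∩ intCube a N).card := by
  have hex : ∀ p : (Fin d → ℤ) × (Fin d → ℤ), p ∈ (H ∩ intCube a N) ×ˢ (intCube a N \ H) →
      ∃ q : Fin d × (Fin d → ℤ), q.2 ∈ latticeBoundary H ∩ intCube a N ∧
        (∀ l, l < q.1 → q.2 l = p.2 l) ∧ ∀ l, q.1 < l → q.2 l = p.1 l := by
    intro p hp
    rw [Finset.mem_product] at hp
    obtain ⟨i, b, h⟩ := exists_boundary_on_path hp.1 hp.2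
    exact ⟨(i, b), h⟩
  have : Nonempty (Fin d) := ⟨⟨0, hd⟩⟩
  choose! q hq1 hq2 hq3 using hex
  set u : (Fin d → ℤ) × (Fin d → ℤ) → (Fin d → ℤ) := fun p l =>
    if l ≤ (q p).1 then p.1 l else p.2 l with hu
  have hcard : d * N ^ (d + 1) * (latticeBoundary H ∩ intCube a N).card =
      ((Finset.univ : Finset (Fin d)) ×ˢ ((latticeBoundary H ∩ intCube a N) ×ˢ
        (intCube a N ×ˢ Finset.Ico (0 : ℤ) N))).card := by
    simp only [Finset.card_product, Finset.card_univ, Fintype.card_fin, card_intCube, Int.card_Ico,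
      sub_zero, Int.toNat_natCast]
    ring
  rw [hcard, ← Finset.card_product]
  refine Finset.card_le_card_of_injOn
    (fun p => ((q p).1, (q p).2, u p, p.2 (q p).1 - a (q p).1)) ?_ ?_
  · intro p hp
    have hp' := Finset.mem_product.1 (Finset.mem_coe.1 hp)
    have h1 := mem_intCube.1 (Finset.mem_inter.1 hp'.1).2
    have h2 := mem_intCube.1 (Finset.mem_sdiff.1 hp'.2).1
    simp only [Finset.coe_product, Set.mem_prod, Finset.mem_coe, Finset.mem_univ, true_and,
      Finset.mem_Ico]
    refine ⟨hq1 p hp, mem_intCube.2 fun l => ?_, ?_⟩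
    · simp only [hu]
      split_ifs
      · exact h1 l
      · exact h2 l
    · have := h2 (q p).1
      constructor <;> omega
  · intro p hp p' hp' heq
    simp only [Prod.mk.injEq] at heq
    obtain ⟨h1, h2, h3, h4⟩ := heq
    rw [← h1] at h4
    refine Prod.ext (funext fun l => ?_) (funext fun l => ?_)
    · rcases le_or_gt l (q p).1 with h | h
      · have := congrFun h3 l
        simpa [hu, ← h1, h] using this
      · rw [← hq3 p hp l h, ← hq3 p' hp' l (h1 ▸ h), h2]
    · rcases lt_trichotomy l (q p).1 with h | h | h
      · rw [← hq2 p hp l h, ← hq2 p' hp' l (h1 ▸ h), h2]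
      · subst h; omega
      · have := congrFun h3 l
        simpa [hu, ← h1, not_le.2 h] using this

/-! ### Sums over arbitrary finite sets are controlled by the boundary -/

/-- The index of the dyadic cube of side `2 ^ i` that contains `n`. -/
def dyadicIndex {d : ℕ} (i : ℕ) (n : Fin d → ℤ) : Fin d → ℤ := fun l => n l / 2 ^ i

/-- The dyadic cube of side `2 ^ i` with index `k`. -/
def dyadicCube {d : ℕ} (i : ℕ) (k : Fin d → ℤ) : Finset (Fin d → ℤ) :=
  intCube (fun l => k l * 2 ^ i) (2 ^ i)

lemma mem_dyadicCube {d : ℕ} {i : ℕ} {k n : Fin d → ℤ} :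
    n ∈ dyadicCube i k ↔ dyadicIndex i n = k := by
  rw [dyadicCube, mem_intCube, funext_iff]
  refine forall_congr' fun l => ?_
  have h2 : (0 : ℤ) < 2 ^ i := by positivity
  rw [dyadicIndex, Int.ediv_eq_iff_of_pos h2]
  push_cast
  rfl

lemma dyadicIndex_succ {d : ℕ} (i : ℕ) (n : Fin d → ℤ) :
    dyadicIndex (i + 1) n = dyadicIndex 1 (dyadicIndex i n) := by
  funext l
  simp only [dyadicIndex, pow_succ, pow_zero, one_mul]
  rw [Int.ediv_ediv_of_nonneg (by positivity)]

lemma dyadicCube_subset {d : ℕ} (i : ℕ) (n : Fin d → ℤ) :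
    dyadicCube i (dyadicIndex i n) ⊆ dyadicCube (i + 1) (dyadicIndex (i + 1) n) := by
  intro n' hn'
  rw [mem_dyadicCube] at hn' ⊢
  rw [dyadicIndex_succ, hn', dyadicIndex_succ i n]

lemma card_dyadicCube {d : ℕ} (i : ℕ) (k : Fin d → ℤ) : (dyadicCube i k).card = (2 ^ i) ^ d :=
  card_intCube _ _

open Classical in
/-- The union of the dyadic cubes of side `2 ^ i` that have more than half of their points
in `H`. -/
def majorityPart {d : ℕ} (H : Finset (Fin d → ℤ)) (i : ℕ) : Finset (Fin d → ℤ) :=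
  (H.biUnion fun n => dyadicCube i (dyadicIndex i n)).filter fun n =>
    (2 ^ i) ^ d < 2 * (H ∩ dyadicCube i (dyadicIndex i n)).card

open Classical in
lemma mem_majorityPart {d : ℕ} {H : Finset (Fin d → ℤ)} {i : ℕ} {n : Fin d → ℤ} :
    n ∈ majorityPart H i ↔ (2 ^ i) ^ d < 2 * (H ∩ dyadicCube i (dyadicIndex i n)).card := by
  rw [majorityPart, Finset.mem_filter, and_iff_right_iff_imp]
  intro h
  have hne : (H ∩ dyadicCube i (dyadicIndex i n)).Nonempty := by
    rw [← Finset.card_pos]; omega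
  obtain ⟨n', hn'⟩ := hne
  rw [Finset.mem_inter, mem_dyadicCube] at hn'
  exact Finset.mem_biUnion.2 ⟨n', hn'.1, mem_dyadicCube.2 hn'.2.symm⟩

lemma majorityPart_zero {d : ℕ} (H : Finset (Fin d → ℤ)) : majorityPart H 0 = H := by
  classical
  ext n
  have hD : dyadicCube 0 (dyadicIndex 0 n) = {n} := by
    ext n'
    rw [mem_dyadicCube, Finset.mem_singleton]
    simp [dyadicIndex, funext_iff]
  rw [mem_majorityPart, hD]
  by_cases hn : n ∈ H
  · simp [Finset.inter_singleton_of_mem hn, hn]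
  · simp [Finset.inter_singleton_of_notMem hn, hn]

lemma exists_majorityPart_eq_empty {d : ℕ} (hd : 2 ≤ d) (H : Finset (Fin d → ℤ)) :
    ∃ i, majorityPart H i = ∅ := by
  classical
  refine ⟨2 * H.card, Finset.eq_empty_of_forall_notMem fun n hn => ?_⟩
  rw [mem_majorityPart] at hn
  have h1 : (H ∩ dyadicCube (2 * H.card) (dyadicIndex (2 * H.card) n)).card ≤ H.card :=
    Finset.card_le_card Finset.inter_subset_left
  have h2 : 2 * H.card < 2 ^ (2 * H.card) := Nat.lt_two_pow_self
  have h3 : 2 ^ (2 * H.card) ≤ (2 ^ (2 * H.card)) ^ d := Nat.le_self_pow (by omega) _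
  omega

-- A dyadic cube `D` and its parent `R` disagree about the majority. Hence one of `H` and its
-- complement fills at least half of `D`, the other at least half of `R`, and the isoperimetric
-- inequality in `R` applies.
open Classical in
lemma pow_le_card_boundary_of_mem_symmDiff {d : ℕ} (hd : 0 < d) {H : Finset (Fin d → ℤ)} {i : ℕ}
    {n : Fin d → ℤ}
    (hn : n ∈ majorityPart H i \ majorityPart H (i + 1) ∨
      n ∈ majorityPart H (i + 1) \ majorityPart H i) :
    (2 ^ i) ^ d ≤ 8 * d * 2 ^ i *
      (latticeBoundary H ∩ dyadicCube (i + 1) (dyadicIndex (i + 1) n)).card := by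
  set D := dyadicCube i (dyadicIndex i n) with hD
  set R := dyadicCube (i + 1) (dyadicIndex (i + 1) n) with hR
  have hDR : D ⊆ R := dyadicCube_subset i n
  have hDc : D.card = (2 ^ i) ^ d := card_dyadicCube _ _
  have hRc : R.card = (2 ^ (i + 1)) ^ d := card_dyadicCube _ _
  have h1 : (H ∩ D).card ≤ (H ∩ R).card := Finset.card_le_card (Finset.inter_subset_inter_left hDR)
  have h2 : (D \ H).card ≤ (R \ H).card := Finset.card_le_card (Finset.sdiff_subset_sdiff hDR subset_rfl)
  have h3 : (D \ H).card + (H ∩ D).card = D.card := by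
    rw [Finset.inter_comm]; exact Finset.card_sdiff_add_card_inter D H
  have h4 : (R \ H).card + (H ∩ R).card = R.card := by
    rw [Finset.inter_comm]; exact Finset.card_sdiff_add_card_inter R H
  have key : (2 ^ i) ^ d * (2 ^ (i + 1)) ^ d ≤ 4 * ((H ∩ R).card * (R \ H).card) := by
    rw [Finset.mem_sdiff, Finset.mem_sdiff, mem_majorityPart, mem_majorityPart, ← hD, ← hR] at hn
    rcases hn with ⟨h5, h6⟩ | ⟨h5, h6⟩
    · have h7 : (2 ^ i) ^ d ≤ 2 * (H ∩ R).card := by omega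
      have h8 : (2 ^ (i + 1)) ^ d ≤ 2 * (R \ H).card := by omega
      calc _ ≤ _ := Nat.mul_le_mul h7 h8
        _ = _ := by ring
    · have h7 : (2 ^ i) ^ d ≤ 2 * (R \ H).card := by omega
      have h8 : (2 ^ (i + 1)) ^ d ≤ 2 * (H ∩ R).card := by omega
      calc _ ≤ _ := Nat.mul_le_mul h7 h8
        _ = _ := by ring
  have h5 := card_inter_mul_card_sdiff_le hd H
    (fun l => dyadicIndex (i + 1) n l * 2 ^ (i + 1)) (2 ^ (i + 1))
  change (H ∩ R).card * (R \ H).card ≤ _ * (latticeBoundary H ∩ R).card at h5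
  have hpos : 0 < ((2 : ℕ) ^ (i + 1)) ^ d := by positivity
  refine Nat.le_of_mul_le_mul_right (key.trans ((Nat.mul_le_mul_left 4 h5).trans (le_of_eq ?_))) hpos
  rw [pow_succ (2 ^ (i + 1)) d, pow_succ 2 i]
  ring

lemma abs_sum_le_of_saturated {d : ℕ} {g : (Fin d → ℤ) → ℝ} {i : ℕ} {B : ℝ}
    (hg : ∀ k, |∑ n ∈ dyadicCube i k, g n| ≤ B) {U : Finset (Fin d → ℤ)}
    (hU : ∀ n ∈ U, dyadicCube i (dyadicIndex i n) ⊆ U) :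
    |∑ n ∈ U, g n| ≤ (U.image (dyadicIndex i)).card * B := by
  classical
  have h1 : ∀ k ∈ U.image (dyadicIndex i),
      ∑ n ∈ U with dyadicIndex i n = k, g n = ∑ n ∈ dyadicCube i k, g n := by
    intro k hk
    obtain ⟨n₀, hn₀, rfl⟩ := Finset.mem_image.1 hk
    refine Finset.sum_congr ?_ fun _ _ => rfl
    ext n
    rw [Finset.mem_filter, mem_dyadicCube]
    exact ⟨fun h => h.2, fun h => ⟨hU n₀ hn₀ (mem_dyadicCube.2 h), h⟩⟩
  rw [← Finset.sum_fiberwise_of_maps_to (g := dyadicIndex i)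
    (fun n hn => Finset.mem_image_of_mem _ hn), Finset.sum_congr rfl h1]
  refine (Finset.abs_sum_le_sum_abs _ _).trans ?_
  rw [← nsmul_eq_mul]
  exact Finset.sum_le_card_nsmul _ _ _ fun k _ => hg k

-- Different parents are disjoint, so their boundary points add up to at most those of `H`; each
-- parent has only `2 ^ d` children.
open Classical in
lemma card_image_dyadicIndex_mul_le {d : ℕ} {H U : Finset (Fin d → ℤ)} {i e : ℕ}
    (hd : d = e + 1)
    (hU : ∀ n ∈ U, (2 ^ i) ^ d ≤ 8 * d * 2 ^ i *
      (latticeBoundary H ∩ dyadicCube (i + 1) (dyadicIndex (i + 1) n)).card) :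
    (U.image (dyadicIndex i)).card * (2 ^ i) ^ e ≤ 2 ^ d * (8 * d) * (latticeBoundary H).card := by
  set Bad := U.image (dyadicIndex (i + 1)) with hBad
  have h1 : (U.image (dyadicIndex i)).card ≤ 2 ^ d * Bad.card := by
    have h2 : Bad = (U.image (dyadicIndex i)).image (dyadicIndex 1) := by
      rw [hBad, Finset.image_image]
      exact Finset.image_congr fun n _ => dyadicIndex_succ i n
    rw [h2]
    refine Finset.card_le_mul_card_image _ _ fun k _ => ?_
    calc _ ≤ (dyadicCube 1 k).card := Finset.card_le_card fun n hn =>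
          mem_dyadicCube.2 (Finset.mem_filter.1 hn).2
      _ = 2 ^ d := by rw [card_dyadicCube, pow_one]
  have h2 : Bad.card * (2 ^ i) ^ e ≤ 8 * d * (latticeBoundary H).card := by
    have h3 : ∀ R ∈ Bad, (2 ^ i) ^ e ≤ 8 * d * (latticeBoundary H ∩ dyadicCube (i + 1) R).card := by
      intro R hR
      obtain ⟨n, hn, rfl⟩ := Finset.mem_image.1 hR
      have h4 := hU n hn
      rw [show ((2 : ℕ) ^ i) ^ d = (2 ^ i) ^ e * 2 ^ i by rw [hd, pow_succ]] at h4
      refine Nat.le_of_mul_le_mul_right (h4.trans (le_of_eq (by ring))) (c := 2 ^ i) (by positivity)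
    calc Bad.card * (2 ^ i) ^ e
        ≤ ∑ R ∈ Bad, 8 * d * (latticeBoundary H ∩ dyadicCube (i + 1) R).card := by
          rw [← smul_eq_mul]; exact Finset.card_nsmul_le_sum _ _ _ h3
      _ = 8 * d * (Bad.biUnion fun R => latticeBoundary H ∩ dyadicCube (i + 1) R).card := by
          rw [← Finset.mul_sum, Finset.card_biUnion]
          intro R _ R' _ hRR'
          refine Finset.disjoint_left.2 ?_
          intro n hn hn'
          rw [Finset.mem_inter, mem_dyadicCube] at hn hn'
          exact hRR' (hn.2.symm.trans hn'.2)
      _ ≤ 8 * d * (latticeBoundary H).card := by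
          refine Nat.mul_le_mul_left _ (Finset.card_le_card ?_)
          exact Finset.biUnion_subset.2 fun R _ => Finset.inter_subset_left
  calc (U.image (dyadicIndex i)).card * (2 ^ i) ^ e ≤ 2 ^ d * Bad.card * (2 ^ i) ^ e :=
        Nat.mul_le_mul_right _ h1
    _ = 2 ^ d * (Bad.card * (2 ^ i) ^ e) := by ring
    _ ≤ 2 ^ d * (8 * d * (latticeBoundary H).card) := Nat.mul_le_mul_left _ h2
    _ = _ := by ring

/-- If the sums of `g` over cubes of side `N` are `O(N ^ (d - 3 / 2))`, then the sums of `g` over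
arbitrary finite sets are bounded by the size of their boundaries. -/
theorem exists_abs_sum_le_card_latticeBoundary {d : ℕ} (hd : 2 ≤ d) :
    ∃ K : ℝ, 0 ≤ K ∧ ∀ (g : (Fin d → ℤ) → ℝ) (C : ℝ),
      (∀ a N, 1 ≤ N → |∑ n ∈ intCube a N, g n| ≤ C * (N ^ (d - 2) * √N)) →
      ∀ H : Finset (Fin d → ℤ), |∑ n ∈ H, g n| ≤ K * C * (latticeBoundary H).card := by
  classical
  obtain ⟨e, rfl⟩ := Nat.exists_eq_add_of_le' hd
  -- The leading 2 accounts for the two halves of the symmetric difference of consecutive majority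
  -- parts. The ratio `r` is what remains of `O(2 ^ (-i (d - 1)))` cubes per boundary point, each
  -- contributing `O(2 ^ (i (d - 3 / 2)))`.
  set K₀ : ℝ := 2 * (2 ^ (e + 2) * (8 * (e + 2))) with hK₀
  set r : ℝ := (√2)⁻¹ with hr
  have hs2 : 1 < √(2 : ℝ) := Real.lt_sqrt_of_sq_lt (by norm_num)
  have hr0 : 0 < r := by positivity
  have hr1 : r < 1 := inv_lt_one_of_one_lt₀ hs2
  refine ⟨K₀ * (1 - r)⁻¹, mul_nonneg (by positivity) (inv_nonneg.2 (by linarith)), ?_⟩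
  intro g C hg H
  set p : ℝ := ((latticeBoundary H).card : ℝ) with hp
  have hC : 0 ≤ C := by
    have := (abs_nonneg _).trans (hg 0 1 le_rfl)
    simpa using this
  have hcube : ∀ i k, |∑ n ∈ dyadicCube i k, g n| ≤ C * ((2 ^ i) ^ e * √(2 ^ i)) := by
    intro i k
    have := hg (fun l => k l * 2 ^ i) (2 ^ i) Nat.one_le_two_pow
    simpa [dyadicCube] using this
  have hU : ∀ i (U : Finset (Fin (e + 2) → ℤ)), (∀ n ∈ U, dyadicCube i (dyadicIndex i n) ⊆ U) →
      (∀ n ∈ U, (2 ^ i) ^ (e + 2) ≤ 8 * (e + 2) * 2 ^ i *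
        (latticeBoundary H ∩ dyadicCube (i + 1) (dyadicIndex (i + 1) n)).card) →
      |∑ n ∈ U, g n| ≤ 2 ^ (e + 2) * (8 * (e + 2)) * C * p * r ^ i := by
    intro i U h1 h2
    refine (abs_sum_le_of_saturated (hcube i) h1).trans ?_
    have h3 := card_image_dyadicIndex_mul_le (H := H) (U := U) (i := i) (e := e + 1) rfl h2
    have h4 : ((U.image (dyadicIndex i)).card : ℝ) * (2 ^ i) ^ (e + 1) ≤
        2 ^ (e + 2) * (8 * (e + 2)) * p := by
      rw [hp]; exact_mod_cast h3
    have hx : (0 : ℝ) < 2 ^ i := by positivity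
    have h5 : r ^ i * √(2 ^ i) = 1 := by
      have h7 : √(2 ^ i : ℝ) = √2 ^ i := by
        rw [← Real.sqrt_sq (by positivity : (0 : ℝ) ≤ √2 ^ i), ← pow_mul, mul_comm, pow_mul,
          Real.sq_sqrt (by norm_num)]
      rw [hr, inv_pow, h7, inv_mul_cancel₀ (by positivity)]
    have h6 : √(2 ^ i : ℝ) = 2 ^ i * r ^ i := by
      rw [← Real.mul_self_sqrt hx.le, mul_assoc, mul_comm √(2 ^ i : ℝ) (r ^ i), h5, mul_one,
        Real.mul_self_sqrt hx.le]
    rw [h6]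
    calc ((U.image (dyadicIndex i)).card : ℝ) * (C * ((2 ^ i) ^ e * (2 ^ i * r ^ i)))
        = ((U.image (dyadicIndex i)).card * (2 ^ i) ^ (e + 1)) * (C * r ^ i) := by
          rw [pow_succ]; ring
      _ ≤ (2 ^ (e + 2) * (8 * (e + 2)) * p) * (C * r ^ i) := by gcongr
      _ = _ := by ring
  have hsat : ∀ i n n', n' ∈ dyadicCube i (dyadicIndex i n) →
      (n' ∈ majorityPart H i ↔ n ∈ majorityPart H i) ∧
      (n' ∈ majorityPart H (i + 1) ↔ n ∈ majorityPart H (i + 1)) := by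
    intro i n n' hn'
    rw [mem_dyadicCube] at hn'
    have h' : dyadicIndex (i + 1) n' = dyadicIndex (i + 1) n := by
      rw [dyadicIndex_succ, hn', dyadicIndex_succ i n]
    simp only [mem_majorityPart, h', hn', and_self]
  have hstep : ∀ i, |∑ n ∈ majorityPart H i, g n - ∑ n ∈ majorityPart H (i + 1), g n| ≤
      K₀ * C * p * r ^ i := by
    intro i
    rw [← Finset.sum_sdiff_sub_sum_sdiff]
    have h1 := hU i (majorityPart H i \ majorityPart H (i + 1))
      (fun n hn n' hn' => by
        rw [Finset.mem_sdiff] at hn ⊢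
        have := hsat i n n' hn'
        rwa [this.1, this.2])
      (fun n hn => by exact_mod_cast pow_le_card_boundary_of_mem_symmDiff (by omega) (Or.inl hn))
    have h2 := hU i (majorityPart H (i + 1) \ majorityPart H i)
      (fun n hn n' hn' => by
        rw [Finset.mem_sdiff] at hn ⊢
        have := hsat i n n' hn'
        rwa [this.1, this.2])
      (fun n hn => by exact_mod_cast pow_le_card_boundary_of_mem_symmDiff (by omega) (Or.inr hn))
    refine (abs_sub _ _).trans ?_
    rw [hK₀]
    linarith
  have htel : ∀ i, |∑ n ∈ H, g n - ∑ n ∈ majorityPart H i, g n| ≤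
      ∑ l ∈ Finset.range i, K₀ * C * p * r ^ l := by
    intro i
    induction i with
    | zero => simp [majorityPart_zero]
    | succ i ih =>
      rw [Finset.sum_range_succ]
      have := abs_add_le (∑ n ∈ H, g n - ∑ n ∈ majorityPart H i, g n)
        (∑ n ∈ majorityPart H i, g n - ∑ n ∈ majorityPart H (i + 1), g n)
      rw [sub_add_sub_cancel] at this
      linarith [hstep i]
  obtain ⟨i, hi⟩ := exists_majorityPart_eq_empty (by omega) H
  have h := htel i
  rw [hi, Finset.sum_empty, sub_zero, ← Finset.mul_sum] at h
  refine h.trans ?_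
  have hgeo : ∑ l ∈ Finset.range i, r ^ l ≤ (1 - r)⁻¹ := by
    rw [← tsum_geometric_of_lt_one hr0.le hr1]
    exact (summable_geometric_of_lt_one hr0.le hr1).sum_le_tsum _ fun _ _ => by positivity
  calc K₀ * C * p * ∑ l ∈ Finset.range i, r ^ l ≤ K₀ * C * p * (1 - r)⁻¹ := by gcongr
    _ = _ := by ring

/-! ### Boolean combinations of boxes -/

/-- Half-open boxes in the unit cube. -/
def IsUnitBox {m : ℕ} (G : Set (Fin m → ℝ)) : Prop :=
  ∃ p q : Fin m → ℝ, (∀ j, 0 ≤ p j ∧ p j ≤ q j ∧ q j ≤ 1) ∧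
    G = Set.pi univ fun j => Ico (p j) (q j)

/-- The translate by `-c` of the half-open unit cube. -/
def shiftedCube {m : ℕ} (c : Fin m → ℝ) : Set (Fin m → ℝ) :=
  {w | ∀ j, 0 ≤ w j + c j ∧ w j + c j < 1}

lemma isUnitBox_shiftedCube_zero {m : ℕ} : IsUnitBox (shiftedCube (0 : Fin m → ℝ)) := by
  refine ⟨0, 1, fun j => by simp, ?_⟩
  ext w
  simp [shiftedCube, Set.mem_pi]

lemma IsUnitBox.inter_shiftedCube {m : ℕ} {G : Set (Fin m → ℝ)} (hG : IsUnitBox G)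
    (c : Fin m → ℝ) : IsUnitBox (G ∩ shiftedCube c) := by
  obtain ⟨p, q, hpq, rfl⟩ := hG
  -- The clamping keeps the endpoints ordered and inside `[0, 1]` even when the intersection is
  -- empty.
  refine ⟨fun j => min 1 (max (p j) (-c j)),
    fun j => max (min 1 (max (p j) (-c j))) (min (q j) (1 - c j)), fun j => ?_, ?_⟩
  · have := hpq j
    exact ⟨le_min zero_le_one (this.1.trans (le_max_left _ _)), le_max_left _ _,
      max_le (min_le_left _ _) ((min_le_left _ _).trans this.2.2)⟩
  · ext w
    simp only [Set.mem_inter_iff, Set.mem_pi, Set.mem_univ, true_implies, shiftedCube,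
      Set.mem_ofPred_eq, ← forall_and]
    refine forall_congr' fun j => ?_
    have := hpq j
    simp only [Set.mem_Ico, lt_max_iff, min_le_iff, lt_min_iff, max_le_iff]
    grind

lemma IsUnitBox.inter_finset {m : ℕ} {ι : Type*} {G : Set (Fin m → ℝ)} (hG : IsUnitBox G)
    (c : ι → Fin m → ℝ) (Z : Finset ι) : IsUnitBox {w ∈ G | ∀ z ∈ Z, w ∈ shiftedCube (c z)} := by
  classical
  induction Z using Finset.induction_on with
  | empty => simpa using hG
  | insert z Z _ ih =>
    convert! ih.inter_shiftedCube (c z) using 1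
    ext w
    simp only [Finset.mem_insert, forall_eq_or_imp, Set.mem_ofPred_eq, Set.mem_inter_iff]
    tauto

lemma HasSmallDiscrepancy.sdiff {d m : ℕ} {α : Fin m → Fin d → ℝ} {G G' : Set (Fin m → ℝ)}
    {ξ ξ' C C' : ℝ} (h : HasSmallDiscrepancy α G ξ C) (h' : HasSmallDiscrepancy α G' ξ' C')
    (hGG' : G' ⊆ G) : HasSmallDiscrepancy α (G \ G') (ξ - ξ') (C + C') := by
  classical
  intro t a N hN
  have h1 := h t a N hN
  have h2 := h' t a N hN
  set f : (Fin d → ℤ) → Fin m → ℝ := fun n j => Int.fract (t j - linMap α (intVec n) j)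
  have h3 : ∀ [DecidablePred fun n => f n ∈ G \ G'],
      (((intCube a N).filter fun n => f n ∈ G \ G').card : ℝ) = ((intCube a N).filter fun n => f n ∈ G).card -
        ((intCube a N).filter fun n => f n ∈ G').card := by
    intro _
    rw [eq_sub_iff_add_eq]
    norm_cast
    rw [← Finset.card_union_of_disjoint]
    · congr 1
      ext n
      simp only [Finset.mem_union, Finset.mem_filter, Set.mem_sdiff]
      have := @hGG' (f n)
      tauto
    · rw [Finset.disjoint_filter]
      intro n _ h4 h5
      exact h4.2 h5
  have h4 := @h3 fun _ => Classical.propDecidable _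
  change |((@Finset.filter _ (fun n => f n ∈ G \ G') (fun _ => Classical.propDecidable _)
    (intCube a N)).card : ℝ) - _| ≤ _
  rw [h4]
  rw [abs_le] at h1 h2 ⊢
  constructor <;> linarith

lemma HasSmallDiscrepancy.empty {d m : ℕ} (α : Fin m → Fin d → ℝ) :
    HasSmallDiscrepancy α ∅ 0 0 := by
  intro t a N _
  simp

/-- Induction on the conditions, for all boxes at once: a positive condition cuts the box down to a
smaller box, a negative one removes that part. Each removal adds two constants, so the result
depends on the pattern. -/
lemma exists_hasSmallDiscrepancy_pattern {d m : ℕ} {ι : Type*} {α : Fin m → Fin d → ℝ}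
    (hα : ∀ G, IsUnitBox G → ∃ ξ C, HasSmallDiscrepancy α G ξ C) (c : ι → Fin m → ℝ)
    (p : ι → Prop) (Z : Finset ι) {G : Set (Fin m → ℝ)} (hG : IsUnitBox G) :
    ∃ ξ C, HasSmallDiscrepancy α {w ∈ G | ∀ z ∈ Z, (p z ↔ w ∈ shiftedCube (c z))} ξ C := by
  classical
  induction Z using Finset.induction_on generalizing G with
  | empty => simpa using hα G hG
  | insert z Z _ ih =>
    obtain ⟨ξ, C, h⟩ := ih (hG.inter_shiftedCube (c z))
    by_cases hz : p z
    · refine ⟨ξ, C, ?_⟩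
      convert! h using 1
      ext w
      simp only [Finset.mem_insert, forall_eq_or_imp, Set.mem_ofPred_eq, Set.mem_inter_iff, hz,
        true_iff]
      tauto
    · obtain ⟨ξ', C', h'⟩ := ih hG
      refine ⟨ξ' - ξ, C' + C, ?_⟩
      convert! h'.sdiff h ?_ using 1
      · ext w
        simp only [Finset.mem_insert, forall_eq_or_imp, Set.mem_ofPred_eq, Set.mem_inter_iff, hz,
          Set.mem_sdiff]
        tauto
      · rintro w ⟨hw1, hw2⟩
        exact ⟨hw1.1, hw2⟩

/-! ### The structure of cubical cut and project sets -/

namespace CutProjectScheme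

variable {d m : ℕ} (S : CutProjectScheme d m)

/-- The coordinate `z - L x` of `(x, z)` in the reference space. -/
def height : AmbientSpace d m →ₗ[ℝ] (Fin m → ℝ) :=
  LinearMap.snd ℝ _ _ - linMap S.coeff ∘ₗ LinearMap.fst ℝ _ _

lemma height_apply (x : AmbientSpace d m) : S.height x = x.2 - linMap S.coeff x.1 := rfl

lemma height_eq_zero_iff {x : AmbientSpace d m} : S.height x = 0 ↔ x ∈ S.E := by
  rw [height_apply, sub_eq_zero]
  exact (LinearMap.mem_graph_iff (linMap S.coeff) x).symm

lemma height_surjective : Function.Surjective S.height := fun w => ⟨(0, w), by simp [height_apply]⟩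

lemma proj_add_projInt (x : AmbientSpace d m) : (S.proj x : AmbientSpace d m) + S.projInt x = x := by
  have h := congrArg (fun f => f x) (Submodule.projection_add_projection_eq_id S.isCompl)
  simpa [proj, projInt] using h

lemma proj_of_mem {x : AmbientSpace d m} (hx : x ∈ S.E) : (S.proj x : AmbientSpace d m) = x := by
  rw [proj, Submodule.projectionOnto_apply_of_mem_left S.isCompl hx]

/-- A vector and its image under `π*` differ by an element of `E`, on which `height` vanishes. In
particular the slice does not depend on the internal space. -/
lemma slice_eq : S.slice = S.height ⁻¹' Icc 0 1 := by
  have hE : ∀ x : S.E, S.height x = 0 := fun x => S.height_eq_zero_iff.2 x.2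
  ext x
  constructor
  · rintro ⟨_, ⟨v, ⟨hv1, hv2⟩, rfl⟩, e, he, rfl⟩
    have h1 : S.height (S.projInt v : AmbientSpace d m) = v.2 := by
      have h2 := congrArg S.height (S.proj_add_projInt v)
      rw [map_add, hE, zero_add] at h2
      rw [h2, height_apply, hv1, map_zero, sub_zero]
    simp only [Set.mem_preimage]
    rw [map_add, S.height_eq_zero_iff.2 he, add_zero, h1]
    exact hv2
  · intro hx
    set v : AmbientSpace d m := (0, S.height x) with hv
    have hxv : x - v ∈ S.E := by
      rw [← height_eq_zero_iff, map_sub, sub_eq_zero]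
      simp [hv, height_apply]
    refine ⟨(S.projInt v : AmbientSpace d m), ⟨v, ⟨rfl, hx⟩, rfl⟩,
      (S.proj v : AmbientSpace d m) + (x - v), S.E.add_mem (S.proj v).2 hxv, ?_⟩
    have := S.proj_add_projInt v
    change (S.projInt v : AmbientSpace d m) + ((S.proj v : AmbientSpace d m) + (x - v)) = x
    rw [← add_assoc, add_comm (S.projInt v : AmbientSpace d m), this, add_sub_cancel]

/-- The point of the lattice `ℤᵏ` with the given coordinates. -/
def latPoint (z : (Fin d → ℤ) × (Fin m → ℤ)) : AmbientSpace d m := (intVec z.1, intVec z.2)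

lemma latPoint_mem (z : (Fin d → ℤ) × (Fin m → ℤ)) : latPoint z ∈ intLattice d m := ⟨z, rfl⟩

lemma exists_latPoint_of_mem {s x : AmbientSpace d m} (hx : x ∈ lat s) :
    ∃ z, x = latPoint z + s := by
  obtain ⟨_, ⟨z, rfl⟩, rfl⟩ := hx
  exact ⟨z, rfl⟩

lemma latPoint_add_mem (z : (Fin d → ℤ) × (Fin m → ℤ)) (s : AmbientSpace d m) :
    latPoint z + s ∈ lat s := ⟨_, latPoint_mem z, rfl⟩

lemma latPoint_add (z z' : (Fin d → ℤ) × (Fin m → ℤ)) :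
    latPoint (z + z') = latPoint z + latPoint z' := by
  ext <;> simp [latPoint, intVec]

lemma latPoint_sub (z z' : (Fin d → ℤ) × (Fin m → ℤ)) :
    latPoint (z - z') = latPoint z - latPoint z' := by
  ext <;> simp [latPoint, intVec]

lemma proj_latPoint_injective : Function.Injective fun z => S.proj (latPoint z) := by
  intro z z' h
  have h1 := S.injOn (latPoint_mem z) (latPoint_mem z') h
  simp only [latPoint, Prod.mk.injEq, funext_iff, intVec, Int.cast_inj] at h1
  exact Prod.ext (funext h1.1) (funext h1.2)

lemma proj_injOn_lat (s : AmbientSpace d m) : Set.InjOn S.proj (lat s) := by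
  intro x hx y hy h
  obtain ⟨z, rfl⟩ := exists_latPoint_of_mem hx
  obtain ⟨z', rfl⟩ := exists_latPoint_of_mem hy
  rw [map_add, map_add, add_left_inj] at h
  rw [S.proj_latPoint_injective h]

lemma lift_proj {s x : AmbientSpace d m} (hx : x ∈ lat s) : S.lift s (S.proj x) = x :=
  S.proj_injOn_lat s (Function.invFunOn_mem ⟨x, hx, rfl⟩) hx
    (Function.invFunOn_eq (f := S.proj) ⟨x, hx, rfl⟩)

/-- The position in the unit cube of the point of `Y_s` with index `n`. -/
def unitCoord (s : AmbientSpace d m) (n : Fin d → ℤ) : Fin m → ℝ :=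
  fun j => Int.fract (S.height s j - linMap S.coeff (intVec n) j)

/-- The point of `ℤᵏ + s` over the index `n` that lies in the slice. -/
def liftPoint (s : AmbientSpace d m) (n : Fin d → ℤ) : AmbientSpace d m :=
  latPoint (n, fun j => -⌊S.height s j - linMap S.coeff (intVec n) j⌋) + s

/-- The point of `Y_s` with index `n`. -/
def point (s : AmbientSpace d m) (n : Fin d → ℤ) : S.E := S.proj (S.liftPoint s n)

variable {S}

lemma liftPoint_mem_lat (s : AmbientSpace d m) (n : Fin d → ℤ) : S.liftPoint s n ∈ lat s :=
  latPoint_add_mem _ s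

lemma liftPoint_fst (s : AmbientSpace d m) (n : Fin d → ℤ) :
    (S.liftPoint s n).1 = intVec n + s.1 := rfl

lemma height_latPoint_add (z : (Fin d → ℤ) × (Fin m → ℤ)) (s : AmbientSpace d m) (j : Fin m) :
    S.height (latPoint z + s) j = S.height s j - linMap S.coeff (intVec z.1) j + z.2 j := by
  rw [map_add, Pi.add_apply, height_apply S (latPoint z)]
  simp only [latPoint, Pi.sub_apply, intVec]
  ring

lemma height_liftPoint (s : AmbientSpace d m) (n : Fin d → ℤ) :
    S.height (S.liftPoint s n) = S.unitCoord s n := by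
  funext j
  rw [liftPoint, height_latPoint_add, unitCoord, Int.fract]
  push_cast
  ring

lemma unitCoord_mem (s : AmbientSpace d m) (n : Fin d → ℤ) :
    S.unitCoord s n ∈ shiftedCube (0 : Fin m → ℝ) :=
  fun j => by simp [unitCoord, Int.fract_nonneg, Int.fract_lt_one]

/-- `height` is continuous and open, so the boundary of the slice is the preimage of the boundary of
the closed cube. Regularity therefore makes the closed and the half-open window equivalent. -/
lemma height_mem_Ioo {s x : AmbientSpace d m} (hs : S.IsRegular s) (hx : x ∈ lat s)
    (hx1 : S.height x ∈ Icc 0 1) (j : Fin m) : 0 < S.height x j ∧ S.height x j < 1 := by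
  have hcont : Continuous S.height := S.height.continuous_of_finiteDimensional
  have hopen : IsOpenMap S.height := S.height.isOpenMap_of_finiteDimensional S.height_surjective
  have h1 : x ∉ frontier S.slice := fun h => by
    have : x ∈ frontier S.slice ∩ lat s := ⟨h, hx⟩
    rw [hs] at this
    exact this
  rw [slice_eq, ← hopen.preimage_frontier_eq_frontier_preimage hcont] at h1
  have h2 : S.height x ∈ interior (Icc 0 1) := by
    by_contra h3
    exact h1 ⟨subset_closure hx1, h3⟩
  rw [← Set.pi_univ_Icc, interior_pi_set Set.finite_univ] at h2
  have h3 := h2 j (Set.mem_univ j)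
  simpa [interior_Icc] using h3

lemma eq_liftPoint {s : AmbientSpace d m} (hs : S.IsRegular s) {z : (Fin d → ℤ) × (Fin m → ℤ)}
    (hz : S.height (latPoint z + s) ∈ Icc 0 1) : latPoint z + s = S.liftPoint s z.1 := by
  rw [liftPoint]
  congr 2
  refine Prod.ext rfl (funext fun j => ?_)
  have h := height_mem_Ioo hs (latPoint_add_mem z s) hz j
  rw [height_latPoint_add] at h
  have : ⌊S.height s j - linMap S.coeff (intVec z.1) j⌋ = -z.2 j := by
    rw [Int.floor_eq_iff]; push_cast; constructor <;> linarith
  simp [this]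

lemma unitCoord_mem_Icc (s : AmbientSpace d m) (n : Fin d → ℤ) : S.unitCoord s n ∈ Icc 0 1 :=
  ⟨fun _ => Int.fract_nonneg _, fun _ => (Int.fract_lt_one _).le⟩

lemma point_mem (s : AmbientSpace d m) (n : Fin d → ℤ) : S.point s n ∈ S.Y s := by
  refine ⟨S.liftPoint s n, ⟨?_, liftPoint_mem_lat s n⟩, rfl⟩
  rw [slice_eq, Set.mem_preimage, height_liftPoint]
  exact unitCoord_mem_Icc s n

lemma Y_eq_range {s : AmbientSpace d m} (hs : S.IsRegular s) : S.Y s = Set.range (S.point s) := by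
  refine Set.Subset.antisymm ?_ (Set.range_subset_iff.2 (point_mem s))
  rintro _ ⟨x, ⟨hx1, hx2⟩, rfl⟩
  obtain ⟨z, rfl⟩ := exists_latPoint_of_mem hx2
  rw [slice_eq] at hx1
  exact ⟨z.1, by rw [eq_liftPoint hs hx1]; rfl⟩

lemma lift_point (s : AmbientSpace d m) (n : Fin d → ℤ) :
    S.lift s (S.point s n) = S.liftPoint s n :=
  S.lift_proj (liftPoint_mem_lat s n)

lemma point_injective (s : AmbientSpace d m) : Function.Injective (S.point s) := by
  intro n n' h
  have h1 := S.proj_injOn_lat s (liftPoint_mem_lat s n) (liftPoint_mem_lat s n') h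
  have h2 := congrArg Prod.fst h1
  rw [liftPoint_fst, liftPoint_fst, add_left_inj] at h2
  funext i
  have := congrFun h2 i
  simpa [intVec] using this

variable (S) in
/-- The condition that selects the lattice displacements that are visible in a patch. -/
def Selects (t : PatchType) (V : Set S.E) (z : (Fin d → ℤ) × (Fin m → ℤ)) : Prop :=
  match t with
  | .typeI => S.proj (latPoint z) ∈ V
  | .typeII => S.rho (latPoint z) ∈ V

/-- A lattice displacement `z` leads from one point of `Y_s` to another exactly when adding its
height keeps the position inside the window. So `s` and `n` influence the patch only through
`unitCoord s n`. -/
lemma patchClass_point {s : AmbientSpace d m} (hs : S.IsRegular s) (t : PatchType) (n : Fin d → ℤ)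
    (V : Set S.E) :
    S.patchClass t s (S.point s n) V = (fun z => S.proj (latPoint z)) ''
      {z | S.Selects t V z ∧ S.unitCoord s n ∈ shiftedCube (S.height (latPoint z))} := by
  have hpatch : ∀ y', y' ∈ S.patch t s (S.point s n) V ↔ ∃ n' z,
      S.liftPoint s n' = latPoint z + S.liftPoint s n ∧ y' = S.point s n' ∧ S.Selects t V z := by
    intro y'
    have key : ∀ n', ∃ z, S.liftPoint s n' = latPoint z + S.liftPoint s n := fun n' => by
      obtain ⟨z, hz⟩ := exists_latPoint_of_mem (liftPoint_mem_lat (S := S) s n)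
      obtain ⟨z', hz'⟩ := exists_latPoint_of_mem (liftPoint_mem_lat (S := S) s n')
      refine ⟨z' - z, ?_⟩
      rw [hz, hz', latPoint_sub]; abel
    have hsel : ∀ n' z, S.liftPoint s n' = latPoint z + S.liftPoint s n →
        (S.point s n' ∈ S.patch t s (S.point s n) V ↔ S.Selects t V z) := by
      intro n' z hz
      have h1 : S.point s n' - S.point s n = S.proj (latPoint z) := by
        rw [point, point, ← map_sub, hz, add_sub_cancel_right]
      have h2 : S.lift s (S.point s n') - S.lift s (S.point s n) = latPoint z := by
        rw [lift_point, lift_point, hz, add_sub_cancel_right]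
      cases t
      · simp only [patch, Selects, Set.mem_ofPred_eq, h1, point_mem, true_and]
      · simp only [patch, Selects, Set.mem_ofPred_eq, h2, point_mem, true_and]
    constructor
    · intro hy
      have hY : y' ∈ S.Y s := by cases t <;> exact hy.1
      rw [Y_eq_range hs] at hY
      obtain ⟨n', rfl⟩ := hY
      obtain ⟨z, hz⟩ := key n'
      exact ⟨n', z, hz, rfl, (hsel n' z hz).1 hy⟩
    · rintro ⟨n', z, hz, rfl, hsz⟩
      exact (hsel n' z hz).2 hsz
  ext v
  constructor
  · rintro ⟨y', hy', rfl⟩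
    obtain ⟨n', z, hz, rfl, hsz⟩ := (hpatch y').1 hy'
    refine ⟨z, ⟨hsz, ?_⟩, ?_⟩
    · have h1 := congrArg S.height hz
      rw [map_add, height_liftPoint, height_liftPoint] at h1
      intro j
      have h2 := congrFun h1 j
      have h3 := unitCoord_mem (S := S) s n' j
      rw [Pi.add_apply] at h2
      simp only [Pi.zero_apply, add_zero] at h3
      rw [add_comm, ← h2]
      exact h3
    · change S.proj (latPoint z) = S.point s n' - S.point s n
      rw [point, point, ← map_sub, hz, add_sub_cancel_right]
  · rintro ⟨z, ⟨hsz, hw⟩, rfl⟩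
    obtain ⟨z₀, hz₀⟩ := exists_latPoint_of_mem (liftPoint_mem_lat (S := S) s n)
    have h1 : latPoint (z + z₀) + s = latPoint z + S.liftPoint s n := by
      rw [latPoint_add, hz₀, add_assoc]
    have h2 : S.height (latPoint (z + z₀) + s) ∈ Icc 0 1 := by
      rw [h1, map_add, height_liftPoint]
      constructor
      · intro j; have := (hw j).1; simpa [add_comm] using this
      · intro j; have := (hw j).2.le; simpa [add_comm] using this
    have h3 := eq_liftPoint hs h2
    rw [h1] at h3
    refine ⟨S.point s (z + z₀).1, (hpatch _).2 ⟨_, z, h3.symm, rfl, hsz⟩, ?_⟩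
    change S.point s (z + z₀).1 - S.point s n = S.proj (latPoint z)
    rw [point, point, ← map_sub, ← h3, add_sub_cancel_right]

end CutProjectScheme

namespace CutProjectScheme

variable {d m : ℕ} {S : CutProjectScheme d m}

/-! ### Acceptance domains of patches -/

lemma rho_add_height (x : AmbientSpace d m) :
    x = (S.rho x : AmbientSpace d m) + ((0 : Fin d → ℝ), S.height x) := by
  ext <;> simp [rho, height_apply]

variable (S) in
-- Both projections fix `E`, so their difference factors through `height`.
lemma exists_norm_rho_sub_proj_le :
    ∃ M : ℝ, 0 ≤ M ∧ ∀ x, ‖S.rho x - S.proj x‖ ≤ M * ‖S.height x‖ := by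
  let f : (Fin m → ℝ) →L[ℝ] S.E :=
    (S.proj ∘ₗ LinearMap.inr ℝ (Fin d → ℝ) (Fin m → ℝ)).toContinuousLinearMap
  refine ⟨‖f‖, f.opNorm_nonneg, fun x => ?_⟩
  have h : S.proj x = S.rho x + f (S.height x) := by
    conv_lhs => rw [rho_add_height (S := S) x, map_add]
    congr 1
    exact Subtype.ext (S.proj_of_mem (S.rho x).2)
  rw [h, sub_add_cancel_left, norm_neg]
  exact f.le_opNorm _

lemma finite_of_latPoint_bounded {Z : Set ((Fin d → ℤ) × (Fin m → ℤ))} {B : ℝ}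
    (hZ : ∀ z ∈ Z, ‖(latPoint z : AmbientSpace d m)‖ ≤ B) : Z.Finite := by
  classical
  refine (Set.finite_Icc ((fun _ => -⌈B⌉, fun _ => -⌈B⌉) : (Fin d → ℤ) × (Fin m → ℤ))
    (fun _ => ⌈B⌉, fun _ => ⌈B⌉)).subset fun z hz => ?_
  have h1 : ∀ i, |(z.1 i : ℝ)| ≤ B := fun i =>
    (norm_le_pi_norm (latPoint z : AmbientSpace d m).1 i).trans
      ((norm_fst_le (latPoint z)).trans (hZ z hz))
  have h2 : ∀ j, |(z.2 j : ℝ)| ≤ B := fun j =>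
    (norm_le_pi_norm (latPoint z : AmbientSpace d m).2 j).trans
      ((norm_snd_le (latPoint z)).trans (hZ z hz))
  have key : ∀ k : ℤ, |(k : ℝ)| ≤ B → -⌈B⌉ ≤ k ∧ k ≤ ⌈B⌉ := fun k hk => by
    have h3 : ((|k| : ℤ) : ℝ) ≤ ⌈B⌉ := by push_cast; exact hk.trans (Int.le_ceil B)
    exact abs_le.1 (by exact_mod_cast h3)
  exact ⟨⟨fun i => (key _ (h1 i)).1, fun j => (key _ (h2 j)).1⟩,
    ⟨fun i => (key _ (h1 i)).2, fun j => (key _ (h2 j)).2⟩⟩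

/-- Selection only bounds a displacement in the direction of `E`; the bound on the height controls
the complementary direction. -/
lemma finite_selected (t : PatchType) {V : Set S.E} (hV : Bornology.IsBounded V) :
    {z | S.Selects t V z ∧ ∀ j, |S.height (latPoint z) j| ≤ 1}.Finite := by
  obtain ⟨M, hM, hMx⟩ := S.exists_norm_rho_sub_proj_le
  obtain ⟨B, hB⟩ := hV.exists_norm_le
  refine finite_of_latPoint_bounded (B := B + M + 1) fun z hz => ?_
  have hh : ‖S.height (latPoint z)‖ ≤ 1 := (pi_norm_le_iff_of_nonneg zero_le_one).2 hz.2
  have hrho : ‖S.rho (latPoint z)‖ ≤ B + M := by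
    have hsel := hz.1
    cases t
    · have h1 := hB _ hsel
      have h2 := hMx (latPoint z)
      have h3 := norm_add_le (S.rho (latPoint z) - S.proj (latPoint z)) (S.proj (latPoint z))
      rw [sub_add_cancel] at h3
      nlinarith
    · have h1 := hB _ hsel
      linarith
  have h4 : ‖((0 : Fin d → ℝ), S.height (latPoint z))‖ ≤ 1 := by
    rw [Prod.norm_def]; simpa using hh
  rw [rho_add_height (S := S) (latPoint z)]
  exact (norm_add_le _ _).trans (add_le_add hrho h4)

lemma abs_le_one_of_mem_shiftedCube {w c : Fin m → ℝ} (hw : w ∈ shiftedCube (0 : Fin m → ℝ))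
    (hwc : w ∈ shiftedCube c) (j : Fin m) : |c j| ≤ 1 := by
  have h1 := hw j
  have h2 := hwc j
  simp only [Pi.zero_apply, add_zero] at h1
  rw [abs_le]; constructor <;> linarith

/-- The points with a prescribed patch are those whose internal coordinate lies in a set with
small discrepancy. -/
theorem exists_acceptance
    (hα : ∀ G : Set (Fin m → ℝ), IsUnitBox G → ∃ ξ C, HasSmallDiscrepancy S.coeff G ξ C)
    (t : PatchType) {V : Set S.E} (hV : Bornology.IsBounded V) (P : Set S.E) :
    ∃ G ξ C, HasSmallDiscrepancy S.coeff G ξ C ∧ ∀ s, S.IsRegular s → ∀ n,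
      (S.patchClass t s (S.point s n) V = P ↔ S.unitCoord s n ∈ G) := by
  have hfin := finite_selected t hV
  set Z := {z | S.Selects t V z ∧ ∀ j, |S.height (latPoint z) j| ≤ 1}
  -- A set that does not consist of such displacements is never a patch class, and its acceptance
  -- domain is empty.
  by_cases hP : P ⊆ (fun z => S.proj (latPoint z)) '' Z
  · obtain ⟨ξ, C, h⟩ := exists_hasSmallDiscrepancy_pattern hα (fun z => S.height (latPoint z))
      (fun z => S.proj (latPoint z) ∈ P) hfin.toFinset isUnitBox_shiftedCube_zero
    refine ⟨_, ξ, C, h, fun s hs n => ?_⟩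
    rw [patchClass_point hs]
    simp only [Set.Finite.mem_toFinset, Set.mem_ofPred_eq, unitCoord_mem s n, true_and]
    constructor
    · rintro rfl z hz
      rw [S.proj_latPoint_injective.mem_set_image]
      exact ⟨fun h => h.2, fun h => ⟨hz.1, h⟩⟩
    · intro h
      ext v
      constructor
      · rintro ⟨z, ⟨hz1, hz2⟩, rfl⟩
        exact (h z ⟨hz1, abs_le_one_of_mem_shiftedCube (unitCoord_mem s n) hz2⟩).2 hz2
      · intro hv
        obtain ⟨z, hz, rfl⟩ := hP hv
        exact ⟨z, ⟨hz.1, (h z hz).1 hv⟩, rfl⟩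
  · refine ⟨∅, 0, 0, HasSmallDiscrepancy.empty _, fun s hs n => ?_⟩
    rw [patchClass_point hs, Set.mem_empty_iff_false, iff_false]
    rintro rfl
    refine hP (Set.image_mono fun z hz => ⟨hz.1, ?_⟩)
    exact abs_le_one_of_mem_shiftedCube (unitCoord_mem s n) hz.2

/-- The acceptance domains of patches of type II are boxes. -/
theorem exists_acceptance_typeII {V : Set S.E} (hV : Bornology.IsBounded V) {s₀ : AmbientSpace d m}
    (hs₀ : S.IsRegular s₀) (n₀ : Fin d → ℤ) :
    ∃ G, IsUnitBox G ∧ ∀ s, S.IsRegular s → ∀ n,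
      (S.patchClass .typeII s (S.point s n) V = S.patchClass .typeII s₀ (S.point s₀ n₀) V ↔
        S.unitCoord s n ∈ G) := by
  have hfin : {z | S.Selects .typeII V z ∧
      S.unitCoord s₀ n₀ ∈ shiftedCube (S.height (latPoint z))}.Finite :=
    (finite_selected .typeII hV).subset fun z hz =>
      ⟨hz.1, abs_le_one_of_mem_shiftedCube (unitCoord_mem s₀ n₀) hz.2⟩
  refine ⟨_, isUnitBox_shiftedCube_zero.inter_finset (fun z => S.height (latPoint z))
    hfin.toFinset, fun s hs n => ?_⟩
  rw [patchClass_point hs, patchClass_point hs₀, S.proj_latPoint_injective.image_injective.eq_iff]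
  simp only [Set.Finite.mem_toFinset, Set.mem_ofPred_eq, unitCoord_mem s n, true_and]
  constructor
  · intro h z hz
    exact ((Set.ext_iff.1 h z).2 hz).2
  · intro h
    ext z
    refine ⟨fun hz => ?_, fun hz => ⟨hz.1, h z hz⟩⟩
    -- Type II selection looks only at `z.1`, and over each `z.1` exactly one lattice vector has the
    -- reference position in its shifted cube. Since heights over the same `z.1` differ by integers,
    -- containment of the reference pattern already forces equality; no negative conditions are
    -- needed, and the domain is a box.
    set z' : (Fin d → ℤ) × (Fin m → ℤ) :=
      (z.1, fun j => -⌊S.unitCoord s₀ n₀ j - linMap S.coeff (intVec z.1) j⌋) with hz'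
    have hheight : ∀ (z : (Fin d → ℤ) × (Fin m → ℤ)) j,
        S.height (latPoint z) j = z.2 j - linMap S.coeff (intVec z.1) j := fun _ _ => rfl
    have h1 : S.Selects .typeII V z' ∧
        S.unitCoord s₀ n₀ ∈ shiftedCube (S.height (latPoint z')) := by
      refine ⟨hz.1, fun j => ?_⟩
      rw [hheight]
      have h2 := Int.floor_le (S.unitCoord s₀ n₀ j - linMap S.coeff (intVec z.1) j)
      have h3 := Int.lt_floor_add_one (S.unitCoord s₀ n₀ j - linMap S.coeff (intVec z.1) j)
      simp only [hz']
      push_cast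
      constructor <;> linarith
    have h2 := h z' h1
    have h3 : z = z' := by
      refine Prod.ext rfl (funext fun j => ?_)
      have h4 := h2 j
      have h5 := hz.2 j
      rw [hheight] at h4 h5
      have h6 : z'.1 = z.1 := rfl
      rw [h6] at h4
      have h7 : (z.2 j : ℝ) < z'.2 j + 1 := by linarith
      have h8 : (z'.2 j : ℝ) < z.2 j + 1 := by linarith
      have h7' : z.2 j < z'.2 j + 1 := by exact_mod_cast h7
      have h8' : z'.2 j < z.2 j + 1 := by exact_mod_cast h8
      omega
    rw [h3]; exact h1

/-! ### Counting occurrences -/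

open Classical in
lemma ncard_point_image (s : AmbientSpace d m) {t : PatchType} {V P : Set S.E} {G : Set (Fin m → ℝ)}
    (hacc : ∀ n, S.patchClass t s (S.point s n) V = P ↔ S.unitCoord s n ∈ G) {X : Set S.E}
    {H : Finset (Fin d → ℤ)} (hX : X = S.point s '' H) :
    X.ncard = H.card ∧ {y' | y' ∈ X ∧ S.patchClass t s y' V = P}.ncard =
      (H.filter fun n => S.unitCoord s n ∈ G).card := by
  constructor
  · rw [hX, Set.ncard_image_of_injective _ (point_injective s), Set.ncard_coe_finset]
  · have : {y' | y' ∈ X ∧ S.patchClass t s y' V = P} =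
        S.point s '' (H.filter fun n => S.unitCoord s n ∈ G : Finset _) := by
      ext y
      simp only [hX, Set.mem_ofPred_eq, Set.mem_image, Finset.coe_filter, Finset.mem_coe]
      constructor
      · rintro ⟨⟨n, hn, rfl⟩, h⟩
        exact ⟨n, ⟨hn, (hacc n).1 h⟩, rfl⟩
      · rintro ⟨n, ⟨hn, h⟩, rfl⟩
        exact ⟨⟨n, hn, rfl⟩, (hacc n).2 h⟩
    rw [this, Set.ncard_image_of_injective _ (point_injective s), Set.ncard_coe_finset]

lemma _root_.HasSmallDiscrepancy.nonneg {α : Fin m → Fin d → ℝ} {G : Set (Fin m → ℝ)} {ξ C : ℝ}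
    (h : HasSmallDiscrepancy α G ξ C) : 0 ≤ C := by
  have := (abs_nonneg _).trans (h 0 0 1 le_rfl)
  simpa using this

lemma boxPoints_eq {s : AmbientSpace d m} (hs : S.IsRegular s) (n₀ : Fin d → ℤ) {R : ℝ}
    (hR : 0 ≤ R) :
    S.boxPoints s (S.point s n₀) R =
      S.point s '' (intCube (fun i => n₀ i - ⌊R⌋₊) (2 * ⌊R⌋₊ + 1) : Finset (Fin d → ℤ)) := by
  have key : ∀ n, (∀ i, |(S.lift s (S.point s n) - S.lift s (S.point s n₀)).1 i| ≤ R) ↔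
      n ∈ intCube (fun i => n₀ i - ⌊R⌋₊) (2 * ⌊R⌋₊ + 1) := by
    intro n
    rw [mem_intCube]
    refine forall_congr' fun i => ?_
    have h1 : (S.lift s (S.point s n) - S.lift s (S.point s n₀)).1 i = ((n i - n₀ i : ℤ) : ℝ) := by
      rw [lift_point, lift_point, Prod.fst_sub, liftPoint_fst, liftPoint_fst]
      simp [intVec]
    have h2 : |((n i - n₀ i : ℤ) : ℝ)| ≤ R ↔ |n i - n₀ i| ≤ (⌊R⌋₊ : ℤ) := by
      rw [← Int.cast_abs, Int.natCast_floor_eq_floor hR, Int.le_floor]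
    rw [h1, h2, abs_le]
    push_cast
    omega
  ext y
  rw [boxPoints, Y_eq_range hs]
  constructor
  · rintro ⟨⟨n, rfl⟩, h⟩
    exact ⟨n, (key n).1 h, rfl⟩
  · rintro ⟨n, h, rfl⟩
    exact ⟨⟨n, rfl⟩, (key n).2 h⟩

theorem isFrequency_of_acceptance (hd : 2 ≤ d) {t : PatchType} {V P : Set S.E}
    {G : Set (Fin m → ℝ)} {ξ C : ℝ} (hG : HasSmallDiscrepancy S.coeff G ξ C)
    (hacc : ∀ s, S.IsRegular s → ∀ n,
      (S.patchClass t s (S.point s n) V = P ↔ S.unitCoord s n ∈ G)) :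
    S.IsFrequency t V P ξ := by
  classical
  intro s hs y hy
  rw [Y_eq_range hs] at hy
  obtain ⟨n₀, rfl⟩ := hy
  rw [tendsto_iff_norm_sub_tendsto_zero]
  have hlim : Tendsto (fun R : ℝ => C * R⁻¹) atTop (𝓝 0) := by
    simpa using tendsto_inv_atTop_zero.const_mul C
  refine squeeze_zero' (Eventually.of_forall fun _ => norm_nonneg _) ?_ hlim
  filter_upwards [eventually_ge_atTop 1] with R hR
  have hR0 : 0 < R := by linarith
  obtain ⟨h1, h2⟩ := ncard_point_image s (hacc s hs) (boxPoints_eq hs n₀ hR0.le)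
  set N := 2 * ⌊R⌋₊ + 1 with hN
  set a : Fin d → ℤ := fun i => n₀ i - ⌊R⌋₊
  have h3 := hG (S.height s) a N (by omega)
  rw [boxFreq, h1, h2, card_intCube]
  have hNR : R ≤ N := by
    have := (Nat.lt_floor_add_one R).le
    rw [hN]; push_cast
    have h0 : (0 : ℝ) ≤ ⌊R⌋₊ := Nat.cast_nonneg _
    linarith
  have hN1 : (1 : ℝ) ≤ N := hR.trans hNR
  have hN0 : (0 : ℝ) < N := by linarith
  have hNd : (0 : ℝ) < (N : ℝ) ^ d := by positivity
  have hsqrt : √(N : ℝ) ≤ N := Real.sqrt_le_self_iff.2 (Or.inr hN1)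
  rw [Real.norm_eq_abs]
  push_cast
  have h4 : ∀ x : ℝ, x / (N : ℝ) ^ d - ξ = (x - ξ * (N : ℝ) ^ d) / (N : ℝ) ^ d := fun x => by
    field_simp
  rw [h4, abs_div, abs_of_pos hNd, div_le_iff₀ hNd]
  refine h3.trans ?_
  rw [mul_assoc]
  refine mul_le_mul_of_nonneg_left ?_ hG.nonneg
  obtain ⟨e, rfl⟩ := Nat.exists_eq_add_of_le' hd
  rw [Nat.add_sub_cancel]
  calc (N : ℝ) ^ e * √N ≤ (N : ℝ) ^ e * N := by gcongr
    _ = R⁻¹ * (R * (N : ℝ) ^ (e + 1)) := by field_simp; ring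
    _ ≤ R⁻¹ * (N * (N : ℝ) ^ (e + 1)) := by gcongr
    _ = R⁻¹ * (N : ℝ) ^ (e + 2) := by ring

open Classical in
lemma exists_abs_card_sub_le (hd : 2 ≤ d) : ∃ K : ℝ, 0 ≤ K ∧
    ∀ (m : ℕ) (α : Fin m → Fin d → ℝ) (G : Set (Fin m → ℝ)) (ξ C : ℝ),
      HasSmallDiscrepancy α G ξ C → ∀ (t : Fin m → ℝ) (H : Finset (Fin d → ℤ)),
      |((H.filter fun n => (fun j => Int.fract (t j - linMap α (intVec n) j)) ∈ G).card : ℝ) -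
        ξ * H.card| ≤ K * C * (latticeBoundary H).card := by
  obtain ⟨K, hK, h⟩ := exists_abs_sum_le_card_latticeBoundary hd
  refine ⟨K, hK, fun m α G ξ C hG t H => ?_⟩
  have hsum : ∀ H : Finset (Fin d → ℤ),
      ∑ n ∈ H, ((if (fun j => Int.fract (t j - linMap α (intVec n) j)) ∈ G then (1 : ℝ) else 0)
        - ξ) =
      ((H.filter fun n => (fun j => Int.fract (t j - linMap α (intVec n) j)) ∈ G).card : ℝ) -
        ξ * H.card := by
    intro H
    rw [Finset.sum_sub_distrib, Finset.card_filter]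
    push_cast
    simp [mul_comm]
  rw [← hsum]
  refine h _ C (fun a N hN => ?_) H
  rw [hsum, card_intCube]
  exact_mod_cast hG t a N hN

end CutProjectScheme

/-! ### Unit cubes -/

/-- The half-open unit cube with lowest vertex `n + v`. -/
def unitCube {d : ℕ} (v : Fin d → ℝ) (n : Fin d → ℤ) : Set (Fin d → ℝ) :=
  Set.pi univ fun i => Ico (n i + v i) (n i + v i + 1)

lemma pairwiseDisjoint_unitCube {d : ℕ} (v : Fin d → ℝ) (H : Set (Fin d → ℤ)) :
    H.PairwiseDisjoint (unitCube v) := by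
  intro n _ n' _ hn
  refine Set.disjoint_left.2 fun x hx hx' => hn (funext fun i => ?_)
  have h1 := hx i (Set.mem_univ i)
  have h2 := hx' i (Set.mem_univ i)
  have h3 : (n i : ℝ) < n' i + 1 := by linarith [h1.1, h2.2]
  have h4 : (n' i : ℝ) < n i + 1 := by linarith [h2.1, h1.2]
  have h3' : n i < n' i + 1 := by exact_mod_cast h3
  have h4' : n' i < n i + 1 := by exact_mod_cast h4
  omega

lemma volume_unitCube {d : ℕ} (v : Fin d → ℝ) (n : Fin d → ℤ) : volume (unitCube v n) = 1 := by
  simp [unitCube, Real.volume_pi_Ico]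

lemma volume_biUnion_unitCube {d : ℕ} (v : Fin d → ℝ) (H : Finset (Fin d → ℤ)) :
    volume (⋃ n ∈ H, unitCube v n) = H.card := by
  rw [measure_biUnion_finset (pairwiseDisjoint_unitCube v _)
    fun n _ => MeasurableSet.univ_pi fun i => measurableSet_Ico]
  simp [volume_unitCube]

lemma card_le_volume_real {d : ℕ} {v : Fin d → ℝ} {H : Finset (Fin d → ℤ)} {X : Set (Fin d → ℝ)}
    (hX : volume X ≠ ⊤) (h : ∀ n ∈ H, unitCube v n ⊆ X) : (H.card : ℝ) ≤ volume.real X := by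
  have h1 := measureReal_mono (μ := volume) (Set.iUnion₂_subset h) hX
  rwa [measureReal_def, volume_biUnion_unitCube, ENNReal.toReal_natCast] at h1

lemma volume_real_le_card {d : ℕ} {v : Fin d → ℝ} {H : Finset (Fin d → ℤ)} {X : Set (Fin d → ℝ)}
    (h : X ⊆ ⋃ n ∈ H, unitCube v n) : volume.real X ≤ H.card := by
  have h1 := measureReal_mono (μ := volume) h (by rw [volume_biUnion_unitCube]; simp)
  rwa [measureReal_def volume (⋃ n ∈ H, unitCube v n), volume_biUnion_unitCube,
    ENNReal.toReal_natCast] at h1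

lemma exists_mem_frontier_segment {F : Type*} [NormedAddCommGroup F] [NormedSpace ℝ F] {A : Set F}
    {a b : F} (ha : a ∈ A) (hb : b ∉ A) : ∃ f ∈ frontier A, f ∈ segment ℝ a b := by
  by_contra! hcon
  have hpre : IsPreconnected (segment ℝ a b) := (convex_segment a b).isPreconnected
  have hcov : segment ℝ a b ⊆ interior A ∪ interior Aᶜ := by
    intro x hx
    have h1 : x ∉ frontier A := fun h => hcon x h hx
    by_cases hxA : x ∈ A
    · left
      by_contra h2
      exact h1 ⟨subset_closure hxA, h2⟩
    · right
      rw [interior_compl]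
      intro h2
      exact h1 ⟨h2, fun h3 => hxA (interior_subset h3)⟩
  have ha' := (hcov (left_mem_segment ℝ a b)).resolve_right fun h => interior_subset h ha
  have hb' := (hcov (right_mem_segment ℝ a b)).resolve_left fun h => hb (interior_subset h)
  obtain ⟨x, _, hx1, hx2⟩ := hpre _ _ isOpen_interior isOpen_interior hcov
    ⟨a, left_mem_segment ℝ a b, ha'⟩ ⟨b, right_mem_segment ℝ a b, hb'⟩
  exact interior_subset hx2 (interior_subset hx1)

namespace CutProjectScheme

variable {d m : ℕ} {S : CutProjectScheme d m}

/-! ### Coordinates on the physical space -/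

variable (S) in
/-- The coordinates on the physical space given by the first `d` coordinates. -/
def chart : S.E ≃ₗ[ℝ] (Fin d → ℝ) :=
  { toFun := fun e => e.1.1
    map_add' := fun _ _ => rfl
    map_smul' := fun _ _ => rfl
    invFun := fun x => ⟨(x, linMap S.coeff x), rfl⟩
    left_inv := fun e => by
      have h : e.1.2 = linMap S.coeff e.1.1 := (LinearMap.mem_graph_iff (linMap S.coeff) e.1).1 e.2
      exact Subtype.ext (Prod.ext rfl h.symm)
    right_inv := fun _ => rfl }

lemma vol_eq (X : Set S.E) : S.vol X = volume.real (S.chart '' X) := rfl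

lemma norm_chart_le (e : S.E) : ‖S.chart e‖ ≤ ‖e‖ := norm_fst_le (e : AmbientSpace d m)

variable (S) in
lemma exists_norm_le_chart : ∃ Λ : ℝ, 0 ≤ Λ ∧ ∀ e : S.E, ‖e‖ ≤ Λ * ‖S.chart e‖ := by
  let f : (Fin d → ℝ) →L[ℝ] S.E := S.chart.symm.toLinearMap.toContinuousLinearMap
  refine ⟨‖f‖, f.opNorm_nonneg, fun e => ?_⟩
  have h : f (S.chart e) = e := S.chart.symm_apply_apply e
  conv_lhs => rw [← h]
  exact f.le_opNorm _

lemma isBounded_chart_image {X : Set S.E} (hX : Bornology.IsBounded X) :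
    Bornology.IsBounded (S.chart '' X) := by
  obtain ⟨B, hB⟩ := hX.exists_norm_le
  refine isBounded_iff_forall_norm_le.2 ⟨B, ?_⟩
  rintro _ ⟨e, he, rfl⟩
  exact (norm_chart_le e).trans (hB e he)

lemma volume_chart_image_ne_top {X : Set S.E} (hX : Bornology.IsBounded X) :
    volume (S.chart '' X) ≠ ⊤ := (isBounded_chart_image hX).measure_lt_top.ne

lemma isBounded_bdryNhd (κ : ℝ) {A : Set S.E} (hA : Bornology.IsBounded A) :
    Bornology.IsBounded (S.bdryNhd κ A) :=
  Bornology.IsBounded.cthickening (hA.closure.subset frontier_subset_closure)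

variable (S) in
/-- Constants that compare the points of `Y_s` with the unit cubes of their indices. -/
lemma exists_norm_sub_point_le : ∃ D₁ D₂ : ℝ, 0 ≤ D₁ ∧ 0 ≤ D₂ ∧
    (∀ (s : AmbientSpace d m) (y : S.E) (n : Fin d → ℤ) (e : S.E),
      S.chart e ∈ unitCube (s.1 - S.chart y) n → ‖e - (S.point s n - y)‖ ≤ D₁) ∧
    ∀ (s : AmbientSpace d m) (n n' : Fin d → ℤ), (∀ i, |n i - n' i| ≤ 1) →
      ‖S.point s n' - S.point s n‖ ≤ D₂ := by
  obtain ⟨M, hM, hMx⟩ := S.exists_norm_rho_sub_proj_le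
  obtain ⟨Λ, hΛ, hΛe⟩ := S.exists_norm_le_chart
  have hrho : ∀ s n, ‖S.rho (S.liftPoint s n) - S.point s n‖ ≤ M := fun s n => by
    refine (hMx _).trans (mul_le_of_le_one_right hM ?_)
    rw [height_liftPoint]
    refine (pi_norm_le_iff_of_nonneg zero_le_one).2 fun j => ?_
    have h := unitCoord_mem_Icc (S := S) s n
    rw [Real.norm_eq_abs, abs_le]
    have h1 := h.1 j
    have h2 := h.2 j
    simp only [Pi.zero_apply, Pi.one_apply] at h1 h2
    constructor <;> linarith
  have hchart : ∀ s n, S.chart (S.rho (S.liftPoint s n)) = intVec n + s.1 := fun s n => rfl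
  -- `Λ` bounds vectors of `E` whose first `d` coordinates are at most 1 in absolute value; `M`
  -- bounds the difference between `ρ` and `π` at a point of the slice.
  refine ⟨Λ + M, Λ + 2 * M, by positivity, by positivity, fun s y n e he => ?_,
    fun s n n' hn => ?_⟩
  · have h1 : ‖e - (S.rho (S.liftPoint s n) - y)‖ ≤ Λ := by
      refine (hΛe _).trans (mul_le_of_le_one_right hΛ ?_)
      rw [map_sub, map_sub, hchart]
      refine (pi_norm_le_iff_of_nonneg zero_le_one).2 fun i => ?_
      have h := he i (Set.mem_univ i)
      simp only [Pi.sub_apply, Pi.add_apply, intVec, Set.mem_Ico] at h ⊢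
      rw [Real.norm_eq_abs, abs_le]
      constructor <;> linarith
    have h2 : e - (S.point s n - y) = (e - (S.rho (S.liftPoint s n) - y)) +
        (S.rho (S.liftPoint s n) - S.point s n) := by abel
    rw [h2]
    exact (norm_add_le _ _).trans (add_le_add h1 (hrho s n))
  · have h1 : ‖S.rho (S.liftPoint s n') - S.rho (S.liftPoint s n)‖ ≤ Λ := by
      refine (hΛe _).trans (mul_le_of_le_one_right hΛ ?_)
      rw [map_sub, hchart, hchart]
      refine (pi_norm_le_iff_of_nonneg zero_le_one).2 fun i => ?_
      simp only [Pi.sub_apply, Pi.add_apply, intVec, add_sub_add_right_eq_sub]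
      rw [Real.norm_eq_abs, abs_sub_comm]
      exact_mod_cast hn i
    have h2 : S.point s n' - S.point s n =
        (S.rho (S.liftPoint s n') - S.rho (S.liftPoint s n)) -
        (S.rho (S.liftPoint s n') - S.point s n') +
        (S.rho (S.liftPoint s n) - S.point s n) := by abel
    rw [h2]
    have h3 := norm_add_le ((S.rho (S.liftPoint s n') - S.rho (S.liftPoint s n)) -
      (S.rho (S.liftPoint s n') - S.point s n')) (S.rho (S.liftPoint s n) - S.point s n)
    have h4 := norm_sub_le (S.rho (S.liftPoint s n') - S.rho (S.liftPoint s n))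
      (S.rho (S.liftPoint s n') - S.point s n')
    linarith [hrho s n, hrho s n']

/-! ### Index sets of bounded regions -/

lemma searchPoints_eq {s : AmbientSpace d m} (hs : S.IsRegular s) (y : S.E) (A : Set S.E) :
    S.searchPoints s y A = S.point s '' {n | S.point s n - y ∈ A} := by
  ext y'
  rw [searchPoints, Y_eq_range hs]
  constructor
  · rintro ⟨⟨n, rfl⟩, h⟩
    exact ⟨n, h, rfl⟩
  · rintro ⟨n, h, rfl⟩
    exact ⟨⟨n, rfl⟩, h⟩

lemma finite_index {A : Set S.E} (hA : Bornology.IsBounded A) (s : AmbientSpace d m) (y : S.E) :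
    {n | S.point s n - y ∈ A}.Finite := by
  obtain ⟨D₁, _, hD₁, _, h1, _⟩ := S.exists_norm_sub_point_le
  obtain ⟨B, hB⟩ := hA.exists_norm_le
  set v := s.1 - S.chart y with hv
  refine (Set.finite_Icc (fun i => -⌈B + D₁ + |v i|⌉) (fun i => ⌈B + D₁ + |v i|⌉)).subset
    fun n hn => ?_
  have h2 : ∀ i, |(n i : ℝ)| ≤ B + D₁ + |v i| := by
    intro i
    set e : S.E := S.chart.symm (intVec n + v) with he
    have hce : S.chart e = intVec n + v := S.chart.apply_symm_apply _
    have h3 := h1 s y n e (by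
      rw [hce]
      intro i _
      simp [intVec, hv])
    have h4 := hB _ hn
    have h5 := norm_add_le (e - (S.point s n - y)) (S.point s n - y)
    rw [sub_add_cancel] at h5
    have h6 := (norm_le_pi_norm (S.chart e) i).trans (norm_chart_le e)
    rw [hce, Pi.add_apply, Real.norm_eq_abs] at h6
    have h7 := abs_sub (intVec n i + v i) (v i)
    rw [add_sub_cancel_right] at h7
    change |(n i : ℝ)| ≤ _ at h7
    linarith
  have key : ∀ i, -⌈B + D₁ + |v i|⌉ ≤ n i ∧ n i ≤ ⌈B + D₁ + |v i|⌉ := fun i => by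
    have h3 : ((|n i| : ℤ) : ℝ) ≤ ⌈B + D₁ + |v i|⌉ := by
      push_cast; exact (h2 i).trans (Int.le_ceil _)
    exact abs_le.1 (by exact_mod_cast h3)
  exact ⟨fun i => (key i).1, fun i => (key i).2⟩

/-- `e` is only a limit of points outside the thickening of the complement; the strict inequality
survives at a nearby such point. -/
lemma core_subset {κ : ℝ} {A : Set S.E} {e p : S.E} (he : e ∈ S.core κ A) (hp : ‖e - p‖ < κ) :
    p ∈ A := by
  by_contra hpA
  have h1 : Metric.ball p κ ∈ 𝓝 e := Metric.isOpen_ball.mem_nhds (by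
    rw [Metric.mem_ball, dist_eq_norm]; exact hp)
  obtain ⟨x, hx1, hx2⟩ := mem_closure_iff_nhds.1 he.2 _ h1
  refine hx2 (Metric.mem_cthickening_of_dist_le x p κ _ (subset_closure hpA) ?_)
  exact (Metric.mem_ball.1 hx1).le

variable (S) in
/-- The discrepancy of the occurrences of a patch in a bounded region is controlled by the
boundary of the region. -/
theorem exists_regionBound (hd : 2 ≤ d) : ∃ κ K : ℝ, 0 < κ ∧ 0 ≤ K ∧
    ∀ (t : PatchType) (V P : Set S.E) (G : Set (Fin m → ℝ)) (ξ C : ℝ),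
      HasSmallDiscrepancy S.coeff G ξ C →
      (∀ s, S.IsRegular s → ∀ n,
        (S.patchClass t s (S.point s n) V = P ↔ S.unitCoord s n ∈ G)) →
      S.RegionBound κ (K * C) t V P := by
  classical
  obtain ⟨D₁, D₂, hD₁, hD₂, hcube, hnbr⟩ := S.exists_norm_sub_point_le
  obtain ⟨K, hK, hcount⟩ := exists_abs_card_sub_le hd
  refine ⟨D₁ + D₂ + 1, K, by positivity, hK, fun t V P G ξ C hG hacc => ⟨ξ,
    isFrequency_of_acceptance hd hG hacc, fun s hs y hy A hA hcore => ?_⟩⟩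
  -- The summand 1 provides the strict inequality that `core_subset` requires.
  set κ := D₁ + D₂ + 1 with hκ
  have hfin := finite_index hA s y
  set H := hfin.toFinset with hH
  have hHmem : ∀ n, n ∈ H ↔ S.point s n - y ∈ A := fun n => by
    rw [hH, Set.Finite.mem_toFinset, Set.mem_ofPred_eq]
  have hsearch : S.searchPoints s y A = S.point s '' (H : Set (Fin d → ℤ)) := by
    rw [searchPoints_eq hs, hH, Set.Finite.coe_toFinset]
  obtain ⟨h1, h2⟩ := ncard_point_image s (hacc s hs) hsearch
  -- The unit cubes of the indices in `H` cover the core: the point of `Y_s` belonging to the cube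
  -- around `e` is within `D₁` of `e` after translation by `-y`.
  have hcoreH : S.vol (S.core κ A) ≤ H.card := by
    rw [vol_eq]
    refine volume_real_le_card (v := s.1 - S.chart y) ?_
    rintro _ ⟨e, he, rfl⟩
    set n : Fin d → ℤ := fun i => ⌊S.chart e i - (s.1 - S.chart y) i⌋ with hn
    have hen : S.chart e ∈ unitCube (s.1 - S.chart y) n := by
      intro i _
      have := Int.floor_le (S.chart e i - (s.1 - S.chart y) i)
      have := Int.lt_floor_add_one (S.chart e i - (s.1 - S.chart y) i)
      simp only [hn]
      constructor <;> linarith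
    refine Set.mem_biUnion ((hHmem n).2 (core_subset he ?_)) hen
    exact lt_of_le_of_lt (hcube s y n e hen) (by linarith)
  -- The points of two neighbouring indices, one in `H` and one not, are within `D₂`, and the
  -- segment between them meets the frontier of `A`. The unit cube of a boundary index thus lies
  -- within `D₁ + D₂` of the frontier.
  have hbdry : ((latticeBoundary H).card : ℝ) ≤ S.vol (S.bdryNhd κ A) := by
    rw [vol_eq]
    refine card_le_volume_real (v := s.1 - S.chart y)
      (volume_chart_image_ne_top (isBounded_bdryNhd κ hA)) fun n hn x hx => ?_
    rw [latticeBoundary, Finset.mem_filter] at hn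
    obtain ⟨hnH, n', hn'H, hnn'⟩ := hn
    refine ⟨S.chart.symm x, ?_, S.chart.apply_symm_apply x⟩
    obtain ⟨f, hf1, hf2⟩ := exists_mem_frontier_segment ((hHmem n).1 hnH)
      (fun h => hn'H ((hHmem n').2 h))
    refine Metric.mem_cthickening_of_dist_le _ f κ _ hf1 ?_
    have h3 := norm_sub_le_of_mem_segment hf2
    rw [sub_sub_sub_cancel_right] at h3
    have h4 := hcube s y n (S.chart.symm x) (by rwa [S.chart.apply_symm_apply])
    have h5 := hnbr s n n' hnn'
    have h6 := norm_sub_le (S.chart.symm x - (S.point s n - y)) (f - (S.point s n - y))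
    rw [sub_sub_sub_cancel_right] at h6
    rw [dist_eq_norm]
    linarith
  have hHpos : (0 : ℝ) < H.card := lt_of_lt_of_le hcore hcoreH
  refine ⟨?_, ?_⟩
  · rw [hsearch]
    refine Set.Nonempty.image _ ?_
    rw [Finset.coe_nonempty, ← Finset.card_pos]
    exact_mod_cast hHpos
  · have h3 := hcount m S.coeff G ξ C hG (S.height s) H
    rw [intrinsicFreq, h1, h2]
    have h4 : ∀ x : ℝ, x / H.card - ξ = (x - ξ * H.card) / H.card := fun x => by field_simp
    rw [h4, abs_div, abs_of_pos hHpos, div_le_iff₀ hHpos]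
    refine h3.trans ?_
    have hKC : 0 ≤ K * C := mul_nonneg hK hG.nonneg
    rw [mul_assoc (K * C) (S.vol _ / S.vol _)]
    refine mul_le_mul_of_nonneg_left ?_ hKC
    calc ((latticeBoundary H).card : ℝ) ≤ S.vol (S.bdryNhd κ A) := hbdry
      _ = S.vol (S.bdryNhd κ A) / S.vol (S.core κ A) * S.vol (S.core κ A) := by field_simp
      _ ≤ S.vol (S.bdryNhd κ A) / S.vol (S.core κ A) * H.card := by
          refine mul_le_mul_of_nonneg_left hcoreH (div_nonneg ?_ hcore.le)
          exact measureReal_nonneg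

end CutProjectScheme

/-! ### Dilations of convex sets -/

/-- For convex `A` one has `R • A + c • A = (R + c) • A`, and `c • A` contains the ball of radius
`κ`. -/
lemma ball_subset_dilation {F : Type*} [NormedAddCommGroup F] [NormedSpace ℝ F] {A : Set F}
    (hA : Convex ℝ A) {r₀ κ R c : ℝ} (hr₀ : 0 < r₀) (hball : Metric.closedBall 0 r₀ ⊆ A)
    (hκ : 0 ≤ κ) (hc : c = κ / r₀) (hR : 0 ≤ R) {x : F} (hx : x ∈ R • A) :
    Metric.closedBall x κ ⊆ (R + c) • A := by
  have hc0 : 0 ≤ c := hc ▸ div_nonneg hκ hr₀.le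
  intro y hy
  rw [hA.add_smul hR hc0]
  refine ⟨x, hx, y - x, ?_, add_sub_cancel x y⟩
  rw [Metric.mem_closedBall, dist_eq_norm] at hy
  rcases hκ.eq_or_lt with rfl | hκ0
  · have h1 : y - x = 0 := norm_le_zero_iff.1 hy
    rw [h1]
    exact ⟨0, hball (Metric.mem_closedBall_self hr₀.le), smul_zero c⟩
  · have hc1 : 0 < c := hc ▸ div_pos hκ0 hr₀
    rw [Set.mem_smul_set_iff_inv_smul_mem₀ hc1.ne']
    refine hball ?_
    rw [mem_closedBall_zero_iff, norm_smul, norm_inv, Real.norm_eq_abs, abs_of_pos hc1,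
      inv_mul_le_iff₀ hc1]
    have : c * r₀ = κ := by rw [hc]; field_simp
    linarith

namespace CutProjectScheme

variable {d m : ℕ} {S : CutProjectScheme d m}

/-- The radius `κ + 1` in `c` replaces the closed thickening by an open one, so that a frontier
point `f` with `dist x f < κ + 1` exists. If `x` were in `(R - c) • A`, a ball about `x` inside `R •
A` would have `f` in its interior. -/
lemma bdryNhd_smul_subset {A : Set S.E} (hA : Convex ℝ A) {r₀ κ R c : ℝ} (hr₀ : 0 < r₀)
    (hball : Metric.closedBall 0 r₀ ⊆ A) (hκ : 0 < κ) (hc : c = (κ + 1) / r₀) (hR : c ≤ R) :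
    S.bdryNhd κ (R • A) ⊆ (R + c) • A \ (R - c) • A := by
  have hc0 : 0 < c := hc ▸ div_pos (by linarith) hr₀
  intro x hx
  obtain ⟨f, hf, hxf⟩ := Metric.mem_thickening_iff.1
    (Metric.cthickening_subset_thickening' (by linarith : 0 < κ + 1) (by linarith) _ hx)
  refine ⟨?_, fun hxR => ?_⟩
  · obtain ⟨a, ha, hfa⟩ := Metric.mem_closure_iff.1 (frontier_subset_closure hf)
      (κ + 1 - dist x f) (by linarith)
    refine ball_subset_dilation hA hr₀ hball (by linarith) hc (by linarith) ha ?_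
    rw [Metric.mem_closedBall]
    linarith [dist_triangle x f a]
  · have h1 := ball_subset_dilation hA hr₀ hball (by linarith) hc (by linarith) hxR
    rw [sub_add_cancel] at h1
    refine hf.2 (interior_mono h1 ?_)
    refine interior_mono Metric.ball_subset_closedBall ?_
    rw [Metric.isOpen_ball.interior_eq, Metric.mem_ball, dist_comm]
    exact hxf

lemma smul_subset_core {A : Set S.E} (hA : Convex ℝ A) {r₀ κ R c : ℝ} (hr₀ : 0 < r₀)
    (hball : Metric.closedBall 0 r₀ ⊆ A) (hκ : 0 < κ) (hc : c = (κ + 1) / r₀) (hR : c ≤ R) :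
    (R - c) • A ⊆ S.core κ (R • A) := by
  intro x hx
  have h1 := ball_subset_dilation hA hr₀ hball (by linarith) hc (by linarith) hx
  rw [sub_add_cancel] at h1
  refine ⟨h1 (Metric.mem_closedBall_self (by linarith)), subset_closure fun h2 => ?_⟩
  rw [Metric.cthickening_closure] at h2
  obtain ⟨f, hf, hxf⟩ := Metric.mem_thickening_iff.1
    (Metric.cthickening_subset_thickening' (by linarith : 0 < κ + 1) (by linarith) _ h2)
  refine hf (h1 ?_)
  rw [Metric.mem_closedBall, dist_comm]
  exact hxf.le

lemma vol_smul {R : ℝ} (hR : 0 ≤ R) (A : Set S.E) : S.vol (R • A) = R ^ d * S.vol A := by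
  rw [vol_eq, vol_eq, image_smul_set, measureReal_def, measureReal_def,
    Measure.addHaar_smul_of_nonneg _ hR]
  simp [ENNReal.toReal_mul, hR]

lemma vol_mono {X X' : Set S.E} (h : X ⊆ X') (hX' : Bornology.IsBounded X') :
    S.vol X ≤ S.vol X' :=
  measureReal_mono (Set.image_mono h) (volume_chart_image_ne_top hX')

/-- The removed set is not assumed measurable, but convex sets are null-measurable. -/
lemma vol_sdiff {X X' : Set S.E} (h : X' ⊆ X) (hX' : Convex ℝ X') (hX : Bornology.IsBounded X) :
    S.vol (X \ X') = S.vol X - S.vol X' := by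
  have hconv : Convex ℝ (S.chart '' X') := hX'.linear_image S.chart.toLinearMap
  rw [vol_eq, Set.image_sdiff S.chart.injective, measureReal_def,
    measure_sdiff (Set.image_mono h) (hconv.nullMeasurableSet volume)
      (volume_chart_image_ne_top (hX.subset h)),
    ENNReal.toReal_sub_of_le (measure_mono (Set.image_mono h)) (volume_chart_image_ne_top hX)]
  rfl

lemma vol_pos {A : Set S.E} (hA : A ∈ 𝓝 (0 : S.E)) (hb : Bornology.IsBounded A) : 0 < S.vol A := by
  have hopen : IsOpenMap S.chart :=
    S.chart.toLinearMap.isOpenMap_of_finiteDimensional S.chart.surjective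
  have h1 : S.chart '' A ∈ 𝓝 (S.chart 0) := hopen.image_mem_nhds hA
  rw [vol_eq, measureReal_def]
  exact ENNReal.toReal_pos (Measure.measure_pos_of_mem_nhds _ h1).ne' (volume_chart_image_ne_top hb)

lemma exists_vol_bdryNhd_le (hd : 1 ≤ d) {A : Set S.E} (hA : Convex ℝ A)
    (hb : Bornology.IsBounded A) (h0 : A ∈ 𝓝 (0 : S.E)) {κ : ℝ} (hκ : 0 < κ) :
    ∃ C R₀ : ℝ, ∀ R, R₀ ≤ R → 0 < S.vol (S.core κ (R • A)) ∧
      S.vol (S.bdryNhd κ (R • A)) / S.vol (S.core κ (R • A)) ≤ C * R⁻¹ := by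
  obtain ⟨r₀, hr₀, hball⟩ := Metric.nhds_basis_closedBall.mem_iff.1 h0
  obtain ⟨c, hc⟩ : ∃ c, c = (κ + 1) / r₀ := ⟨_, rfl⟩
  have hc0 : 0 < c := hc ▸ div_pos (by linarith) hr₀
  have hvA : 0 < S.vol A := vol_pos h0 hb
  have h0A : (0 : S.E) ∈ A := mem_of_mem_nhds h0
  -- For `R ≥ 2c` the core contains `(R - c) • A`, of volume at least `(R / 2) ^ d * vol A`, and the
  -- shell has volume `((R + c) ^ d - (R - c) ^ d) * vol A`, at most `2 c d (2R) ^ (d - 1) * vol A`.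
  refine ⟨2 * c * d * 2 ^ (d - 1) * 2 ^ d, 2 * c, fun R hR => ?_⟩
  have hR0 : 0 < R := by linarith
  have hbR : ∀ r : ℝ, Bornology.IsBounded (r • A) := fun r => hb.smul₀ r
  have hcore : (R / 2) ^ d * S.vol A ≤ S.vol (S.core κ (R • A)) := by
    have h1 := vol_mono (smul_subset_core hA hr₀ hball hκ hc (by linarith))
      ((hbR R).subset Set.inter_subset_left)
    rw [vol_smul (by linarith)] at h1
    refine le_trans ?_ h1
    gcongr
    linarith
  have hcore0 : 0 < (R / 2) ^ d * S.vol A := by positivity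
  have hcorepos := lt_of_lt_of_le hcore0 hcore
  refine ⟨hcorepos, ?_⟩
  have hbd : S.vol (S.bdryNhd κ (R • A)) ≤ 2 * c * d * (2 * R) ^ (d - 1) * S.vol A := by
    have h1 := vol_mono (bdryNhd_smul_subset hA hr₀ hball hκ hc (by linarith))
      ((hbR (R + c)).subset Set.sdiff_subset)
    have hsub : (R - c) • A ⊆ (R + c) • A := by
      have := Convex.add_smul hA (p := R - c) (q := 2 * c) (by linarith) (by linarith)
      rw [show R - c + 2 * c = R + c by ring] at this
      rw [this]
      exact fun x hx => ⟨x, hx, 0, ⟨0, h0A, smul_zero _⟩, add_zero x⟩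
    rw [vol_sdiff hsub (hA.smul _) (hbR _), vol_smul (by linarith), vol_smul (by linarith),
      ← sub_mul] at h1
    refine h1.trans (mul_le_mul_of_nonneg_right ?_ hvA.le)
    have h2 := abs_pow_sub_pow_le (R + c) (R - c) d
    rw [abs_of_nonneg (show 0 ≤ R + c by linarith), abs_of_nonneg (show 0 ≤ R - c by linarith),
      max_eq_left (by linarith), show R + c - (R - c) = 2 * c by ring,
      abs_of_pos (show 0 < 2 * c by linarith)] at h2
    refine (le_abs_self _).trans (h2.trans ?_)
    gcongr
    linarith
  calc S.vol (S.bdryNhd κ (R • A)) / S.vol (S.core κ (R • A))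
      ≤ (2 * c * d * (2 * R) ^ (d - 1) * S.vol A) / ((R / 2) ^ d * S.vol A) := by
        gcongr
    _ = 2 * c * d * 2 ^ (d - 1) * 2 ^ d * R⁻¹ := by
        obtain ⟨e, rfl⟩ := Nat.exists_eq_add_of_le' hd
        rw [Nat.add_sub_cancel, mul_pow, div_pow, pow_succ R e]
        field_simp

lemma RegionBound.dilationBound {κ K : ℝ} {t : PatchType} {V P A : Set S.E}
    (h : S.RegionBound κ K t V P) (hK : 0 ≤ K) (hb : Bornology.IsBounded A) {C R₀ : ℝ}
    (hA : ∀ R, R₀ ≤ R → 0 < S.vol (S.core κ (R • A)) ∧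
      S.vol (S.bdryNhd κ (R • A)) / S.vol (S.core κ (R • A)) ≤ C * R⁻¹) :
    S.DilationBound A (K * C) R₀ t V P := by
  obtain ⟨ξ, hξ, hbound⟩ := h
  refine ⟨ξ, hξ, fun s hs y hy R hR => ?_⟩
  obtain ⟨h1, h2⟩ := hA R hR
  refine (hbound s hs y hy (R • A) (hb.smul₀ R) h1).2.trans ?_
  rw [mul_assoc]
  exact mul_le_mul_of_nonneg_left h2 hK

end CutProjectScheme

/-! ### Assembly of the corollary -/

theorem mainTheorem6 (d m : ℕ) (hd : 2 ≤ d) (hm : 1 ≤ m) :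
    ∀ᵐ α : Fin m → Fin d → ℝ, ∀ S : CutProjectScheme d m, S.coeff = α →
      (∃ κ : ℝ, 0 < κ ∧
        (∃ C : ℝ, ∀ (Ω : Set S.E) (r : ℝ) (P : Set S.E), S.IsPatch .typeII Ω r P →
          S.RegionBound κ C .typeII (r • Ω) P) ∧
        (∀ (Ω : Set S.E) (r : ℝ) (P : Set S.E), S.IsPatch .typeI Ω r P →
          ∃ C : ℝ, S.RegionBound κ C .typeI (r • Ω) P)) ∧
      (∀ A : Set S.E, Convex ℝ A → Bornology.IsBounded A → A ∈ 𝓝 (0 : S.E) →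
        (∃ C R₀ : ℝ, ∀ (Ω : Set S.E) (r : ℝ) (P : Set S.E), S.IsPatch .typeII Ω r P →
          S.DilationBound A C R₀ .typeII (r • Ω) P) ∧
        (∀ (Ω : Set S.E) (r : ℝ) (P : Set S.E), S.IsPatch .typeI Ω r P →
          ∃ C R₀ : ℝ, S.DilationBound A C R₀ .typeI (r • Ω) P)) := by
  have hd' : (2 : ℝ) ≤ d := by exact_mod_cast hd
  have hm' : (1 : ℝ) ≤ m := by exact_mod_cast hm
  filter_upwards [ae_tsum_linearForms_lt_top d m (ε := 1 / (2 * (d + 2 * m))) (by positivity)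
    (by rw [div_lt_one (by positivity)]; linarith)] with α hα S hS
  subst hS
  obtain ⟨κ, K, hκ, hK, hregion⟩ := S.exists_regionBound hd
  set C₀ : ℝ := 2 ^ (m + d + 1) * (frequencySum S.coeff (1 / (2 * (d + 2 * m)))).toReal +
    m * 2 ^ m + 1 with hC₀
  -- The same `C₀` serves all boxes; this is the source of the uniformity for type II.
  have hbox : ∀ G : Set (Fin m → ℝ), IsUnitBox G → ∃ ξ, HasSmallDiscrepancy S.coeff G ξ C₀ := by
    rintro _ ⟨p, q, hpq, rfl⟩
    exact ⟨_, HasSmallDiscrepancy.box hd hα hpq⟩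
  have hC₀0 : 0 ≤ C₀ := by
    have : 0 ≤ (frequencySum S.coeff (1 / (2 * (d + 2 * m)))).toReal := ENNReal.toReal_nonneg
    positivity
  have hII : ∀ (Ω : Set S.E) (r : ℝ) (P : Set S.E), S.IsPatch .typeII Ω r P →
      S.RegionBound κ (K * C₀) .typeII (r • Ω) P := by
    rintro Ω r P ⟨_, hΩ, _, _, s, hs, y, hy, rfl⟩
    rw [CutProjectScheme.Y_eq_range hs] at hy
    obtain ⟨n, rfl⟩ := hy
    obtain ⟨G, hG, hacc⟩ := CutProjectScheme.exists_acceptance_typeII (hΩ.smul₀ r) hs n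
    obtain ⟨ξ, hξ⟩ := hbox G hG
    exact hregion _ _ _ G ξ C₀ hξ hacc
  have hI : ∀ (Ω : Set S.E) (r : ℝ) (P : Set S.E), S.IsPatch .typeI Ω r P →
      ∃ C : ℝ, 0 ≤ C ∧ S.RegionBound κ C .typeI (r • Ω) P := by
    rintro Ω r P ⟨_, hΩ, _⟩
    obtain ⟨G, ξ, C, hG, hacc⟩ := CutProjectScheme.exists_acceptance
      (fun G hG => (hbox G hG).imp fun ξ h => ⟨C₀, h⟩) .typeI (hΩ.smul₀ r) P
    exact ⟨K * C, mul_nonneg hK hG.nonneg, hregion _ _ _ G ξ C hG hacc⟩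
  refine ⟨⟨κ, hκ, ⟨K * C₀, hII⟩, fun Ω r P hP => (hI Ω r P hP).imp fun _ h => h.2⟩,
    fun A hA hb h0 => ?_⟩
  obtain ⟨C, R₀, hCR⟩ := CutProjectScheme.exists_vol_bdryNhd_le (by omega) hA hb h0 hκ
  refine ⟨⟨K * C₀ * C, R₀, fun Ω r P hP =>
    (hII Ω r P hP).dilationBound (mul_nonneg hK hC₀0) hb hCR⟩, fun Ω r P hP => ?_⟩
  obtain ⟨C', hC', h⟩ := hI Ω r P hP
  exact ⟨C' * C, R₀, h.dilationBound hC' hb hCR⟩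

end
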